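/- Consider a network of $n$ linear discrete-time control systems $\Sigma_i:\ x^{(i)}_{k+1}=A_ix^{(i)}_k+B_iu^{(i)}_k$, $i=1,\dots,n$, with $A_i\in\mathbb R^{d_i\times d_i}$, $B_i\in\mathbb R^{d_i\times m_i}$ and control value sets $U_i\subset\mathbb R^{m_i}$ such that each $U_i$ has at least two elements and is contained in the closure of its interior (for instance $U_i=\mathbb R^{m_i}$, $m_i\ge 1$). Let $\Sigma$ be the product system on $X=\prod_i\mathbb R^{d_i}$ with controls in $U=\prod_iU_i$, right-hand side $f(x,u)=(A_ix_i+B_iu_i)_i$, and let $\varphi(k,x,\omega)$ be its state at time $k$ when started at $x$ with control sequence $\omega\in U^{\mathbb Z_+}=\prod_iU_i^{\mathbb Z_+}$. Assume that every pair $(A_i,B_i)$ is controllable, i.e. with unconstrained controls in $\mathbb R^{m_i}$ every state can be steered to every state in finite time. Let $Q\subset X$ be compact with nonempty interior, and assume that there is a compact set $K\subset\operatorname{int}Q$ such that for every $x\in Q$ there is $u\in U$ with $f(x,u)\in\operatorname{int}K$. For an integer $\tau>0$, a set $\mathcal S\subset U^{\mathbb Z_+}$ is called $(\tau,Q)$-spanning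 if for every $x\in Q$ there is $\omega\in\mathcal S$ with $\varphi(k,x,\omega)\in\operatorname{int}Q$ for $k=1,\dots,\tau$. Put $$H_\tau(Q)=\Bigl\{\tfrac1\tau(\log_2\#\mathcal S_1,\dots,\log_2\#\mathcal S_n):\ \mathcal S_i\subset U_i^{\mathbb Z_+}\text{ finite},\ \mathcal S_1\times\cdots\times\mathcal S_n\ (\tau,Q)\text{-spanning}\Bigr\},$$ and let the network entropy set be $H(Q)=\bigcap_{\tau>0}\operatorname{cl}\bigcup_{t\ge\tau}H_t(Q)\subset\mathbb R^n$. Then $$H(Q)=\prod_{i=1}^n\Bigl[\sum_{\lambda\in\sigma(A_i)}\max\{0,n_\lambda\log_2|\lambda|\},\ \infty\Bigr),$$ where $\sigma(A_i)$ is the set of complex eigenvalues of $A_i$, $n_\lambda$ is the algebraic multiplicity of $\lambda$, and $\log_2 0=-\infty$. -/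

import Mathlib

/-- A discrete-time control system `x_{k+1} = f (x_k, u_k)` with state space `X` and control value
set `U`, the right-hand side being continuous in the state for each fixed control value. -/
structure ControlSystem (X U : Type*) [TopologicalSpace X] where
  /-- The right-hand side. -/
  f : X → U → X
  /-- Continuity in the state. -/
  continuous_f : ∀ u, Continuous fun x => f x u

namespace ControlSystem

section Single

variable {X U : Type*} [TopologicalSpace X]

/-- The transition map `φ(k, x, ω)`. -/
def transition (C : ControlSystem X U) (ω : ℕ → U) : ℕ → X → X
  | 0, x => x
  | k + 1, x => C.f (C.transition ω k x) (ω k)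

/-- `S` is `(τ, Q)`-spanning: every `x ∈ Q` has a control sequence `ω ∈ S` with
`φ(k, x, ω) ∈ int Q` for `k = 1, …, τ`. -/
def IsSpanning (C : ControlSystem X U) (τ : ℕ) (Q : Set X) (S : Set (ℕ → U)) : Prop :=
  ∀ x ∈ Q, ∃ ω ∈ S, ∀ k : ℕ, 1 ≤ k → k ≤ τ → C.transition ω k x ∈ interior Q

/-- The strong invariance condition on `Q`: there is a compact set `K ⊆ int Q` such that every
point of `Q` can be steered into `int K` in one step of time. -/
def StronglyInvariant (C : ControlSystem X U) (Q : Set X) : Prop :=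
  ∃ K : Set X, IsCompact K ∧ K ⊆ interior Q ∧ ∀ x ∈ Q, ∃ u : U, C.f x u ∈ interior K

end Single

section Network

variable {ι : Type*} {X U : ι → Type*} [∀ i, TopologicalSpace (X i)]

/-- The overall system of a network: the direct product of its subsystems. -/
def network (C : ∀ i, ControlSystem (X i) (U i)) : ControlSystem (∀ i, X i) (∀ i, U i) where
  f x u := fun i => (C i).f (x i) (u i)
  continuous_f u :=
    continuous_pi fun i => ((C i).continuous_f (u i)).comp (continuous_apply i)

/-- The product of finite sets of control sequences of the subsystems, as a set of control
sequences of the overall system. -/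
def controlProduct (S : ∀ i, Finset (ℕ → U i)) : Set (ℕ → ∀ i, U i) :=
  {ω | ∀ i, (fun k => ω k i) ∈ S i}

/-- The set `H_τ(Q)` of finite-time entropy vectors: all vectors `(1/τ) (log₂ #S_i)_i` with
finite sets `S_i` whose product is `(τ, Q)`-spanning. -/
noncomputable def finiteTimeEntropySet (C : ∀ i, ControlSystem (X i) (U i)) (Q : Set (∀ i, X i))
    (τ : ℕ) : Set (ι → ℝ) :=
  {ξ | ∃ S : ∀ i, Finset (ℕ → U i),
    (network C).IsSpanning τ Q (controlProduct S) ∧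
      ∀ i, ξ i = (1 / (τ : ℝ)) * Real.logb 2 ((S i).card : ℝ)}

/-- The network entropy set `H(Q) = ⋂_{τ > 0} cl ⋃_{t ≥ τ} H_t(Q)`. -/
noncomputable def networkEntropySet (C : ∀ i, ControlSystem (X i) (U i)) (Q : Set (∀ i, X i)) :
    Set (ι → ℝ) :=
  ⋂ (τ : ℕ) (_ : 0 < τ), closure (⋃ (t : ℕ) (_ : τ ≤ t), finiteTimeEntropySet C Q t)

end Network

/-- The linear system `x_{k+1} = A x_k + B u_k` on `ℝ^d` with control values in `U ⊆ ℝ^m`. -/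
def linear {d m : ℕ} (A : Matrix (Fin d) (Fin d) ℝ) (B : Matrix (Fin d) (Fin m) ℝ)
    (U : Set (Fin m → ℝ)) : ControlSystem (Fin d → ℝ) U where
  f x u := A.mulVec x + B.mulVec (u : Fin m → ℝ)
  continuous_f _ := (continuous_const.matrix_mulVec continuous_id).add continuous_const

end ControlSystem

/-- The pair `(A, B)` is controllable: with unconstrained controls, `x_{k+1} = A x_k + B u_k` can be
steered from every state to every state in finite time. -/
def IsControllablePair {d m : ℕ} (A : Matrix (Fin d) (Fin d) ℝ) (B : Matrix (Fin d) (Fin m) ℝ) :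
    Prop :=
  ∀ x y : Fin d → ℝ, ∃ (T : ℕ) (ω : ℕ → (Set.univ : Set (Fin m → ℝ))),
    (ControlSystem.linear A B Set.univ).transition ω T x = y

/-- `∑_{λ ∈ σ(A)} max {0, n_λ log₂ |λ|}`, summed over the distinct complex eigenvalues `λ` of `A`,
with algebraic multiplicities `n_λ`. The term of `λ = 0` is `0` (here `Real.logb 2 0 = 0`), in
agreement with the convention `log 0 = -∞`. -/
noncomputable def unstableLogSum {d : ℕ} (A : Matrix (Fin d) (Fin d) ℝ) : ℝ :=
  ∑ l ∈ (A.map (algebraMap ℝ ℂ)).charpoly.roots.toFinset,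
    max 0 (((A.map (algebraMap ℝ ℂ)).charpoly.rootMultiplicity l : ℝ) * Real.logb 2 ‖l‖)

/-!
For the lower bound, project to the sum of the generalized eigenspaces of `A i` for the eigenvalues
of modulus `> 1`. There `A i ^ t` multiplies volumes by `unstableDet (A i) ^ t`, whereas the
projection of `Q` is covered by its preimages under the affine maps `x ↦ A i ^ t x + b ω`,
`ω ∈ S i`; hence `S i` has at least `unstableDet (A i) ^ t` elements.

For the upper bound, only the steering problem near the origin requires many controls. Strong
invariance contracts the convex hull of `Q_i - Q_i`, where `Q_i` is the projection of `Q`, so a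
subsystem can be steered from the unit ball into any small ball. By a volume count, for each
`γ > unstableDet (A i)` and large `T`, the unit ball is a union of at most `γ ^ T` cells whose
images under `A i ^ T` are small; a control that steers the centre of a cell close to the origin
returns the whole cell to the unit ball. Concatenating and scaling these words yields small
corrections that keep nearby trajectories nearby. Superposed on finitely many trajectories which
stay in `K` under controls bounded away from the boundaries of the `U i`, they form product
spanning sets, and enlarging these realizes every larger growth rate.
-/

section Spectral

open Polynomial

theorem exists_mul_eq_of_forall_algEquiv {K L : Type*} [Field K] [Field L] [Algebra K L]
    [Normal K L] {s : L → Prop} (hs : ∀ (σ : L ≃ₐ[K] L) (z : L), s z → s (σ z)) {p : K[X]}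
    (hp : p ≠ 0) :
    ∃ q r : K[X], q * r = p ∧ (∀ z : L, aeval z q = 0 → s z) ∧ ∀ z : L, aeval z r = 0 → ¬ s z := by
  induction p using WfDvdMonoid.induction_on_irreducible with
  | zero => exact absurd rfl hp
  | unit u hu =>
    have no_root (v : K[X]) (hv : IsUnit v) (z : L) : aeval z v ≠ 0 := (hv.map (aeval z)).ne_zero
    exact ⟨u, 1, mul_one u, fun z hz => absurd hz (no_root u hu z),
      fun z hz => absurd hz (no_root 1 isUnit_one z)⟩
  | mul p g hp0 hg ih =>
    obtain ⟨q, r, rfl, hq, hr⟩ := ih hp0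
    have conj {z w : L} (hz : aeval z g = 0) (hw : aeval w g = 0) (hsz : s z) : s w := by
      obtain ⟨σ, rfl⟩ := isConjRoot_iff_exists_algEquiv.1
        ((minpoly.eq_of_irreducible hg hw).symm.trans (minpoly.eq_of_irreducible hg hz))
      exact hs σ z hsz
    by_cases hgs : ∃ z : L, aeval z g = 0 ∧ s z
    · obtain ⟨z, hz, hsz⟩ := hgs
      refine ⟨g * q, r, mul_assoc g q r, fun w hw => ?_, hr⟩
      rw [map_mul, mul_eq_zero] at hw
      exact hw.elim (fun h => conj hz h hsz) (hq w)
    · refine ⟨q, g * r, mul_left_comm q g r, hq, fun w hw hsw => ?_⟩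
      rw [map_mul, mul_eq_zero] at hw
      exact hw.elim (fun h => hgs ⟨w, h, hsw⟩) (fun h => hr w h hsw)

theorem mem_aroots_charpoly_iff_mem_spectrum {K L V : Type*} [Field K] [Field L] [Algebra K L]
    [AddCommGroup V] [Module K V] [FiniteDimensional K V] (f : Module.End K V) (z : L) :
    z ∈ f.charpoly.aroots L ↔ z ∈ spectrum L (f.baseChange L) := by
  rw [aroots, mem_roots (f.charpoly_monic.map _).ne_zero, ← LinearMap.charpoly_baseChange,
    ← Module.End.hasEigenvalue_iff_isRoot_charpoly, Module.End.hasEigenvalue_iff_mem_spectrum]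

theorem aeval_eq_zero_of_mem_aroots_charpoly {K L V : Type*} [Field K] [Field L] [Algebra K L]
    [AddCommGroup V] [Module K V] [FiniteDimensional K V] {f : Module.End K V} {p : K[X]}
    (hp : aeval f p = 0) {z : L} (hz : z ∈ f.charpoly.aroots L) : aeval z p = 0 := by
  obtain ⟨x, hx⟩ := (Module.End.hasEigenvalue_iff_mem_spectrum.2
    ((mem_aroots_charpoly_iff_mem_spectrum f z).1 hz)).exists_hasEigenvector
  have h_aeval : aeval (f.baseChange L) (p.map (algebraMap K L)) = 0 := by
    rw [aeval_map_algebraMap]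
    exact (aeval_algHom_apply (Module.End.baseChangeHom K L V) f p).trans (by rw [hp, map_zero])
  have h_smul := Module.End.aeval_apply_of_hasEigenvector (p := p.map (algebraMap K L)) hx
  rw [h_aeval, LinearMap.zero_apply, eval_map_algebraMap] at h_smul
  exact (smul_eq_zero.1 h_smul.symm).resolve_right hx.2

theorem aeval_restrict_ker_aeval {K V : Type*} [CommRing K] [AddCommGroup V] [Module K V]
    {f : Module.End K V} {p : K[X]}
    (hf : ∀ x ∈ LinearMap.ker (aeval f p), f x ∈ LinearMap.ker (aeval f p)) :
    aeval (f.restrict hf) p = 0 := by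
  have h1 (q : K[X]) (x : LinearMap.ker (aeval f p)) :
      (aeval (f.restrict hf) q x : V) = aeval f q x := by
    induction q using Polynomial.induction_on' with
    | add a b ha hb => simp [ha, hb]
    | monomial n a =>
      rw [aeval_monomial, aeval_monomial, Module.End.pow_restrict n]
      simp [Algebra.algebraMap_eq_smul_one]
  ext x : 2
  exact (h1 p x).trans x.2

theorem exists_isCompl_forall_mem_aroots_charpoly {K L V : Type*} [Field K] [Field L] [Algebra K L]
    [Normal K L] [IsAlgClosed L] [AddCommGroup V] [Module K V] [FiniteDimensional K V]
    (f : Module.End K V) {s : L → Prop} (hs : ∀ (σ : L ≃ₐ[K] L) (z : L), s z → s (σ z)) :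
    ∃ (W₁ W₂ : Submodule K V) (h₁ : ∀ x ∈ W₁, f x ∈ W₁) (h₂ : ∀ x ∈ W₂, f x ∈ W₂),
      IsCompl W₁ W₂ ∧ (∀ z ∈ (f.restrict h₁).charpoly.aroots L, s z) ∧
        ∀ z ∈ (f.restrict h₂).charpoly.aroots L, ¬ s z := by
  obtain ⟨q, r, hqr, hq, hr⟩ :=
    exists_mul_eq_of_forall_algEquiv (L := L) hs f.charpoly_monic.ne_zero
  have coprime : IsCoprime q r :=
    (isCoprime_iff_aeval_ne_zero_of_isAlgClosed K L q r).2 fun z =>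
      not_and_or.1 fun h => hr z h.2 (hq z h.1)
  have invariant (p : K[X]) : ∀ x ∈ LinearMap.ker (aeval f p), f x ∈ LinearMap.ker (aeval f p) := by
    intro x hx
    have comm : aeval f p * f = f * aeval f p := by
      simpa only [aeval_X] using ((Commute.all p X).map (aeval f)).eq
    rw [LinearMap.mem_ker, ← Module.End.mul_apply, comm, Module.End.mul_apply,
      LinearMap.mem_ker.1 hx, map_zero]
  refine ⟨_, _, invariant q, invariant r,
    ⟨disjoint_ker_aeval_of_isCoprime f coprime, codisjoint_iff.2 ?_⟩,
    fun z hz => hq z (aeval_eq_zero_of_mem_aroots_charpoly (aeval_restrict_ker_aeval _) hz),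
    fun z hz => hr z (aeval_eq_zero_of_mem_aroots_charpoly (aeval_restrict_ker_aeval _) hz)⟩
  rw [sup_ker_aeval_eq_ker_aeval_mul_of_coprime f coprime, hqr, f.aeval_self_charpoly,
    LinearMap.ker_zero]

theorem charpoly_eq_mul_charpoly_restrict {K V : Type*} [Field K] [AddCommGroup V] [Module K V]
    [FiniteDimensional K V] {f : Module.End K V} {W₁ W₂ : Submodule K V} (h : IsCompl W₁ W₂)
    (h₁ : ∀ x ∈ W₁, f x ∈ W₁) (h₂ : ∀ x ∈ W₂, f x ∈ W₂) :
    f.charpoly = (f.restrict h₁).charpoly * (f.restrict h₂).charpoly := by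
  rw [← LinearMap.charpoly_prodMap,
    ← LinearEquiv.charpoly_conj (Submodule.prodEquivOfIsCompl W₁ W₂ h)]
  congr 1
  refine LinearMap.ext fun x => ?_
  obtain ⟨y, rfl⟩ := (Submodule.prodEquivOfIsCompl W₁ W₂ h).surjective x
  simp [LinearEquiv.conj_apply_apply]

section UnstableDet

variable {V : Type*} [AddCommGroup V] [Module ℝ V] [FiniteDimensional ℝ V]

/-- The product of `max 1 |λ|` over the complex eigenvalues `λ` of `f`, counted with algebraic
multiplicity: the factor by which `f` expands volume along its unstable subspace. -/
noncomputable def unstableDet (f : Module.End ℝ V) : ℝ :=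
  f.charpoly.mapMahlerMeasure (algebraMap ℝ ℂ)

theorem unstableDet_eq_prod (f : Module.End ℝ V) :
    unstableDet f = ((f.charpoly.aroots ℂ).map fun z => max 1 ‖z‖).prod := by
  rw [unstableDet, mapMahlerMeasure_eq, mahlerMeasure_eq_leadingCoeff_mul_prod_roots,
    (f.charpoly_monic.map _).leadingCoeff, norm_one, one_mul]

theorem one_le_unstableDet (f : Module.End ℝ V) : 1 ≤ unstableDet f :=
  Monic.one_le_mapMahlerMeasure (v := algebraMap ℝ ℂ) Complex.isometry_ofReal f.charpoly_monic

theorem unstableDet_eq_abs_det {f : Module.End ℝ V}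
    (hf : ∀ z ∈ f.charpoly.aroots ℂ, 1 ≤ ‖z‖) : unstableDet f = |LinearMap.det f| := by
  have h_prod : (f.charpoly.aroots ℂ).prod = ((LinearMap.det f : ℝ) : ℂ) := by
    rw [aroots, ← LinearMap.charpoly_baseChange,
      ← Module.End.det_eq_prod_roots_charpoly_of_splits (IsAlgClosed.splits _),
      LinearMap.det_baseChange]
    rfl
  rw [unstableDet_eq_prod, Multiset.map_congr rfl fun z hz => max_eq_right (hf z hz),
    ← Real.norm_eq_abs, ← Complex.norm_real, ← h_prod]
  exact (map_multiset_prod (normHom (α := ℂ)) _).symm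

theorem unstableDet_eq_one {f : Module.End ℝ V} (hf : ∀ z ∈ f.charpoly.aroots ℂ, ‖z‖ ≤ 1) :
    unstableDet f = 1 := by
  rw [unstableDet_eq_prod, Multiset.map_congr rfl fun z hz => max_eq_left (hf z hz),
    Multiset.prod_map_one]

/-- A decomposition of the space into an `f`-invariant subspace on which all eigenvalues of `f` have
modulus `> 1` and an `f`-invariant complement on which they have modulus `≤ 1`. -/
structure UnstableSplitting (f : Module.End ℝ V) where
  unstable : Submodule ℝ V
  stable : Submodule ℝ V
  isCompl : IsCompl unstable stable
  map_unstable : ∀ x ∈ unstable, f x ∈ unstable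
  map_stable : ∀ x ∈ stable, f x ∈ stable
  one_lt_norm : ∀ z ∈ (f.restrict map_unstable).charpoly.aroots ℂ, 1 < ‖z‖
  norm_le_one : ∀ z ∈ (f.restrict map_stable).charpoly.aroots ℂ, ‖z‖ ≤ 1

theorem nonempty_unstableSplitting (f : Module.End ℝ V) : Nonempty (UnstableSplitting f) := by
  have : Normal ℝ ℂ := normal_iff.2 fun z =>
    ⟨Algebra.IsIntegral.isIntegral z, IsAlgClosed.splits _⟩
  have norm_algEquiv (σ : ℂ ≃ₐ[ℝ] ℂ) (z : ℂ) : ‖σ z‖ = ‖z‖ := by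
    rcases Complex.real_algHom_eq_id_or_conj σ with h | h
    · exact congrArg norm (DFunLike.congr_fun h z)
    · exact (congrArg norm (DFunLike.congr_fun h z)).trans (Complex.norm_conj z)
  obtain ⟨W₁, W₂, h₁, h₂, hW, hu, hs⟩ := exists_isCompl_forall_mem_aroots_charpoly f
    (s := fun z : ℂ => 1 < ‖z‖) fun σ z hz => by rwa [norm_algEquiv]
  exact ⟨⟨W₁, W₂, hW, h₁, h₂, hu, fun z hz => not_lt.1 (hs z hz)⟩⟩

namespace UnstableSplitting

variable {f : Module.End ℝ V} (P : UnstableSplitting f)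

/-- The restriction of `f` to the unstable subspace. -/
noncomputable def unstableMap : Module.End ℝ P.unstable := f.restrict P.map_unstable

/-- The restriction of `f` to the stable subspace. -/
noncomputable def stableMap : Module.End ℝ P.stable := f.restrict P.map_stable

/-- The coordinates of a vector along the unstable and the stable subspace. -/
noncomputable def coords : V ≃ₗ[ℝ] P.unstable × P.stable :=
  (Submodule.prodEquivOfIsCompl P.unstable P.stable P.isCompl).symm

theorem coords_apply (x : V) : P.coords (f x) = P.unstableMap.prodMap P.stableMap (P.coords x) := by
  obtain ⟨y, rfl⟩ := P.coords.symm.surjective x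
  rw [LinearEquiv.apply_symm_apply, ← LinearEquiv.eq_symm_apply]
  simp [coords, unstableMap, stableMap]

theorem coords_pow_apply (T : ℕ) (x : V) :
    P.coords ((f ^ T) x) = ((P.unstableMap ^ T).prodMap (P.stableMap ^ T)) (P.coords x) := by
  induction T with
  | zero => rfl
  | succ T ih =>
    rw [pow_succ', Module.End.mul_apply, P.coords_apply, ih, pow_succ', pow_succ']
    rfl

theorem abs_det_unstableMap : |LinearMap.det P.unstableMap| = unstableDet f := by
  have h_stable : unstableDet P.stableMap = 1 := unstableDet_eq_one P.norm_le_one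
  have h_mul : unstableDet f = unstableDet P.unstableMap * unstableDet P.stableMap := by
    rw [unstableDet, charpoly_eq_mul_charpoly_restrict P.isCompl P.map_unstable P.map_stable,
      mapMahlerMeasure_mul]
    rfl
  rw [h_mul, h_stable, mul_one]
  exact (unstableDet_eq_abs_det fun z hz => (P.one_lt_norm z hz).le).symm

theorem det_unstableMap_ne_zero : LinearMap.det P.unstableMap ≠ 0 := by
  rw [← abs_pos, abs_det_unstableMap]
  exact one_pos.trans_le (one_le_unstableDet f)

end UnstableSplitting

end UnstableDet

theorem unstableLogSum_eq_logb_unstableDet {d : ℕ} (A : Matrix (Fin d) (Fin d) ℝ) :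
    unstableLogSum A = Real.logb 2 (unstableDet (Matrix.toLin' A)) := by
  have h_roots : (A.map (algebraMap ℝ ℂ)).charpoly.roots =
      (Matrix.toLin' A).charpoly.aroots ℂ := by
    rw [aroots, Matrix.charpoly_toLin', Matrix.charpoly_map]
  rw [unstableLogSum, unstableDet_eq_prod, ← h_roots, Finset.prod_multiset_map_count,
    Real.logb_prod]
  · refine Finset.sum_congr rfl fun z _ => ?_
    have h_max : Real.logb 2 (max 1 ‖z‖) = max 0 (Real.logb 2 ‖z‖) := by
      rw [Real.logb, ← Real.posLog_eq_log_max_one (norm_nonneg z), Real.posLog_apply,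
        ← max_div_div_right (Real.log_nonneg one_le_two), zero_div, Real.logb]
    rw [count_roots, Real.logb_pow, h_max, mul_max_of_nonneg _ _ (Nat.cast_nonneg _), mul_zero]
  · exact fun z _ => pow_ne_zero _ (zero_lt_one.trans_le (le_max_left 1 ‖z‖)).ne'

end Spectral

section Growth

open Filter Topology Polynomial

theorem eventually_mul_pow_le_pow {a b : ℝ} (ha : 0 < a) (hab : a < b) (c : ℝ) :
    ∀ᶠ T : ℕ in atTop, c * a ^ T ≤ b ^ T := by
  filter_upwards [(tendsto_pow_atTop_atTop_of_one_lt
    ((one_lt_div ha).2 hab)).eventually_ge_atTop c] with T hT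
  rwa [← le_div_iff₀ (pow_pos ha T), ← div_pow]

theorem tendsto_one_div_mul_logb_ceil_pow {a : ℝ} (ha : 1 ≤ a) :
    Tendsto (fun t : ℕ => 1 / (t : ℝ) * Real.logb 2 ⌈a ^ t⌉₊) atTop (𝓝 (Real.logb 2 a)) := by
  have h_upper : Tendsto (fun t : ℕ => 1 / (t : ℝ) + Real.logb 2 a) atTop (𝓝 (Real.logb 2 a)) := by
    simpa using (tendsto_one_div_atTop_nhds_zero_nat (𝕜 := ℝ)).add_const (Real.logb 2 a)
  have h_bounds : ∀ᶠ t : ℕ in atTop, Real.logb 2 a ≤ 1 / (t : ℝ) * Real.logb 2 ⌈a ^ t⌉₊ ∧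
      1 / (t : ℝ) * Real.logb 2 ⌈a ^ t⌉₊ ≤ 1 / (t : ℝ) + Real.logb 2 a := by
    filter_upwards [eventually_gt_atTop 0] with t ht
    have ht_pos : (0 : ℝ) < t := Nat.cast_pos.2 ht
    have h_pow : 1 ≤ a ^ t := one_le_pow₀ ha
    have h_pow_pos : 0 < a ^ t := one_pos.trans_le h_pow
    rw [one_div, le_inv_mul_iff₀ ht_pos, inv_mul_le_iff₀ ht_pos, mul_add,
      mul_inv_cancel₀ ht_pos.ne', ← Real.logb_pow]
    refine ⟨Real.logb_le_logb_of_le one_lt_two h_pow_pos (Nat.le_ceil _), ?_⟩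
    calc Real.logb 2 ⌈a ^ t⌉₊ ≤ Real.logb 2 (2 * a ^ t) :=
          Real.logb_le_logb_of_le one_lt_two (h_pow_pos.trans_le (Nat.le_ceil _))
            (Nat.ceil_le_two_mul (by linarith))
      _ = 1 + Real.logb 2 (a ^ t) := by
          rw [Real.logb_mul two_ne_zero h_pow_pos.ne', Real.logb_self_eq_one one_lt_two]
  exact tendsto_of_tendsto_of_tendsto_of_le_of_le' tendsto_const_nhds h_upper
    (h_bounds.mono fun _ h => h.1) (h_bounds.mono fun _ h => h.2)

theorem exists_norm_pow_le_of_spectralRadius_lt {R : Type*} [NormedRing R] [NormedAlgebra ℂ R]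
    [CompleteSpace R] {a : R} {η : ℝ} (hη : 0 < η) (ha : spectralRadius ℂ a < ENNReal.ofReal η) :
    ∃ C : ℝ, ∀ T : ℕ, ‖a ^ T‖ ≤ C * η ^ T := by
  have h_eventually : ∀ᶠ T : ℕ in atTop, ‖a ^ T‖ ≤ η ^ T := by
    have h_lim := spectrum.pow_norm_pow_one_div_tendsto_nhds_spectralRadius a
    filter_upwards [h_lim.eventually_lt_const ha, eventually_ne_atTop 0] with T hT hT0
    have h_root : ‖a ^ T‖ ^ (T : ℝ)⁻¹ ≤ η := by
      simpa only [one_div] using ((ENNReal.ofReal_lt_ofReal_iff hη).1 hT).le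
    calc ‖a ^ T‖ = (‖a ^ T‖ ^ (T : ℝ)⁻¹) ^ T := (Real.rpow_inv_natCast_pow (norm_nonneg _) hT0).symm
      _ ≤ η ^ T := by gcongr
  have h_isBigO : (fun T : ℕ => a ^ T) =O[atTop] fun T : ℕ => η ^ T :=
    Asymptotics.IsBigO.of_norm_eventuallyLE h_eventually
  obtain ⟨C, -, hC⟩ := Asymptotics.bound_of_isBigO_nat_atTop h_isBigO
  exact ⟨C, fun T => (hC (pow_pos hη T).ne').trans_eq
    (by rw [Real.norm_of_nonneg (pow_nonneg hη.le T)])⟩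

theorem exists_norm_pow_mulVec_le {n : Type*} [Fintype n] [DecidableEq n] {M : Matrix n n ℝ}
    {r η : ℝ} (hM : ∀ z ∈ M.charpoly.aroots ℂ, ‖z‖ ≤ r) (hr : 0 ≤ r) (hη : r < η) :
    ∃ C : ℝ, ∀ (T : ℕ) (x : n → ℝ), ‖(M ^ T).mulVec x‖ ≤ C * η ^ T * ‖x‖ := by
  let := Matrix.linftyOpNormedRing (n := n) (α := ℂ)
  let := Matrix.linftyOpNormedAlgebra (R := ℂ) (n := n) (α := ℂ)
  have : CompleteSpace (Matrix n n ℂ) := FiniteDimensional.complete ℂ _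
  let N : Matrix n n ℂ := M.map (algebraMap ℝ ℂ)
  have h_radius : spectralRadius ℂ N < ENNReal.ofReal η := by
    refine (iSup₂_le fun z hz => ?_).trans_lt
      ((ENNReal.ofReal_lt_ofReal_iff (hr.trans_lt hη)).2 hη)
    rw [Matrix.mem_spectrum_iff_isRoot_charpoly, Matrix.charpoly_map,
      ← mem_roots (M.charpoly_monic.map _).ne_zero] at hz
    rw [← enorm_eq_nnnorm, ← ofReal_norm]
    exact ENNReal.ofReal_le_ofReal (hM z hz)
  obtain ⟨C, hC⟩ := exists_norm_pow_le_of_spectralRadius_lt (hr.trans_lt hη) h_radius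
  have norm_ofReal (y : n → ℝ) : ‖fun i => (y i : ℂ)‖ = ‖y‖ := by
    simp only [Pi.norm_def, Complex.nnnorm_real]
  refine ⟨C, fun T x => ?_⟩
  have h_map : N ^ T = (M ^ T).map (algebraMap ℝ ℂ) :=
    (map_pow (algebraMap ℝ ℂ).mapMatrix M T).symm
  calc ‖(M ^ T).mulVec x‖ = ‖(N ^ T).mulVec fun i => (x i : ℂ)‖ := by
        rw [h_map, ← norm_ofReal]
        exact congrArg norm (funext fun i => (algebraMap ℝ ℂ).map_mulVec (M ^ T) x i)
    _ ≤ ‖N ^ T‖ * ‖x‖ := (Matrix.linfty_opNorm_mulVec _ _).trans_eq (by rw [norm_ofReal])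
    _ ≤ C * η ^ T * ‖x‖ := by gcongr; exact hC T

theorem exists_norm_pow_apply_le {V : Type*} [NormedAddCommGroup V] [NormedSpace ℝ V]
    [FiniteDimensional ℝ V] {f : Module.End ℝ V} {r η : ℝ}
    (hf : ∀ z ∈ f.charpoly.aroots ℂ, ‖z‖ ≤ r) (hr : 0 ≤ r) (hη : r < η) :
    ∃ C : ℝ, ∀ (T : ℕ) (x : V), ‖(f ^ T) x‖ ≤ C * η ^ T * ‖x‖ := by
  let b := Module.finBasis ℝ V
  let E := b.equivFunL
  obtain ⟨C, hC⟩ := exists_norm_pow_mulVec_le (M := LinearMap.toMatrix b b f)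
    (by rwa [LinearMap.charpoly_toMatrix]) hr hη
  have equiv_pow (T : ℕ) (x : V) :
      E ((f ^ T) x) = (LinearMap.toMatrix b b f ^ T).mulVec (E x) := by
    rw [LinearMap.toMatrix_pow]
    exact (LinearMap.toMatrix_mulVec_repr b b (f ^ T) x).symm
  refine ⟨‖E.symm.toContinuousLinearMap‖ * |C| * ‖E.toContinuousLinearMap‖, fun T x => ?_⟩
  have hη0 : 0 ≤ η := hr.trans hη.le
  calc ‖(f ^ T) x‖ = ‖E.symm ((LinearMap.toMatrix b b f ^ T).mulVec (E x))‖ := by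
        rw [← equiv_pow, E.symm_apply_apply]
    _ ≤ ‖E.symm.toContinuousLinearMap‖ * (C * η ^ T * ‖E x‖) :=
        E.symm.toContinuousLinearMap.le_opNorm_of_le (hC T _)
    _ ≤ ‖E.symm.toContinuousLinearMap‖ * (|C| * η ^ T * (‖E.toContinuousLinearMap‖ * ‖x‖)) := by
        gcongr
        · exact le_abs_self C
        · exact E.toContinuousLinearMap.le_opNorm x
    _ = ‖E.symm.toContinuousLinearMap‖ * |C| * ‖E.toContinuousLinearMap‖ * η ^ T * ‖x‖ := by ring

theorem inv_mem_aroots_charpoly {K L V : Type*} [Field K] [Field L] [Algebra K L] [AddCommGroup V]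
    [Module K V] [FiniteDimensional K V] {f g : Module.End K V} (hfg : f * g = 1) {z : L}
    (hz : z ∈ g.charpoly.aroots L) : z⁻¹ ∈ f.charpoly.aroots L := by
  obtain ⟨x, hx⟩ := (Module.End.hasEigenvalue_iff_mem_spectrum.2
    ((mem_aroots_charpoly_iff_mem_spectrum g z).1 hz)).exists_hasEigenvector
  have h_smul : z • f.baseChange L x = x := by
    rw [← map_smul, ← hx.apply_eq_smul, ← LinearMap.comp_apply, ← LinearMap.baseChange_comp]
    exact (congrArg (fun h : Module.End K V => h.baseChange L x) hfg).trans
      (by rw [Module.End.one_eq_id, LinearMap.baseChange_id, LinearMap.id_apply])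
  have hz0 : z ≠ 0 := fun h => hx.2 (by rw [← h_smul, h, zero_smul])
  refine (mem_aroots_charpoly_iff_mem_spectrum f z⁻¹).2
    (Module.End.hasEigenvalue_iff_mem_spectrum.1 (Module.End.hasEigenvalue_of_hasEigenvector
      ⟨Module.End.mem_eigenspace_iff.2 ?_, hx.2⟩))
  rw [← smul_right_inj hz0, smul_inv_smul₀ hz0, h_smul]

end Growth

section Covering

open MeasureTheory Metric Module

theorem exists_finset_dist_le_and_card_mul_addHaar_ball_le {E : Type*} [NormedAddCommGroup E]
    [NormedSpace ℝ E] [FiniteDimensional ℝ E] [MeasurableSpace E] [BorelSpace E] (μ : Measure E)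
    [μ.IsAddHaarMeasure] {W : Set E} (hW : Bornology.IsBounded W) {r : ℝ} (hr : 0 < r) :
    ∃ F : Finset E, ↑F ⊆ W ∧ (∀ x ∈ W, ∃ c ∈ F, dist x c ≤ 2 * r) ∧
      F.card * μ (ball 0 r) ≤ μ (thickening r W) := by
  lift r to NNReal using hr.le
  have h_packing : packingNumber (2 * r) W ≠ ⊤ := by
    obtain ⟨N, -, hN_finite, hN⟩ := exists_finite_isCover_of_isCompact_closure
      (NNReal.coe_pos.1 hr).ne' hW.isCompact_closure
    exact ((packingNumber_two_mul_le_externalCoveringNumber r W).trans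
      hN.externalCoveringNumber_le_encard |>.trans_lt hN_finite.encard_lt_top).ne
  have h_finite : (maximalSeparatedSet (2 * r) W).Finite := by
    rwa [← Set.encard_ne_top_iff, encard_maximalSeparatedSet h_packing]
  refine ⟨h_finite.toFinset, h_finite.coe_toFinset.trans_subset maximalSeparatedSet_subset,
    fun x hx => ?_, ?_⟩
  · obtain ⟨c, hc, hxc⟩ := Set.mem_iUnion₂.1
      ((isCover_maximalSeparatedSet h_packing).subset_iUnion_closedBall hx)
    exact ⟨c, h_finite.mem_toFinset.2 hc, hxc⟩
  · have h_disjoint : (h_finite.toFinset : Set E).PairwiseDisjoint fun c => ball c r := by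
      intro c hc c' hc' hcc'
      rw [h_finite.coe_toFinset] at hc hc'
      have h_sep : ((2 * r : NNReal) : ENNReal) < edist c c' :=
        isSeparated_maximalSeparatedSet hc hc' hcc'
      rw [edist_nndist, ENNReal.coe_lt_coe] at h_sep
      exact ball_disjoint_ball (by rw [← two_mul]; exact_mod_cast h_sep.le)
    calc h_finite.toFinset.card * μ (ball 0 r)
        = ∑ c ∈ h_finite.toFinset, μ (ball c r) := by
          simp only [Measure.addHaar_ball_center, Finset.sum_const, nsmul_eq_mul]
      _ = μ (⋃ c ∈ h_finite.toFinset, ball c r) :=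
          (measure_biUnion_finset h_disjoint fun c _ => measurableSet_ball).symm
      _ ≤ μ (thickening r W) := by
          refine measure_mono (Set.iUnion₂_subset fun c hc => ball_subset_thickening ?_ _)
          exact maximalSeparatedSet_subset (h_finite.mem_toFinset.1 hc)

theorem natCast_le_of_mul_addHaar_ball_le {E : Type*} [NormedAddCommGroup E]
    [NormedSpace ℝ E] [FiniteDimensional ℝ E] [MeasurableSpace E] [BorelSpace E] (μ : Measure E)
    [μ.IsAddHaarMeasure] {N : ℕ} {D ρ r : ℝ} (hD : 0 ≤ D) (hρ : 0 ≤ ρ) (hr : 0 < r)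
    (h : N * μ (ball 0 r) ≤ ENNReal.ofReal D * μ (closedBall 0 ρ)) :
    N ≤ D * (ρ / r) ^ finrank ℝ E := by
  have h_ball : μ (ball 0 1) ≠ 0 := (measure_ball_pos μ 0 one_pos).ne'
  rw [Measure.addHaar_ball_of_pos μ 0 hr, Measure.addHaar_closedBall μ 0 hρ,
    ← mul_assoc, ← mul_assoc, ENNReal.mul_le_mul_iff_left h_ball measure_ball_lt_top.ne,
    ← ENNReal.ofReal_natCast, ← ENNReal.ofReal_mul (Nat.cast_nonneg N),
    ← ENNReal.ofReal_mul hD, ENNReal.ofReal_le_ofReal_iff (by positivity)] at h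
  rwa [div_pow, ← mul_div_assoc, le_div_iff₀ (by positivity)]

section ProdMap

variable {E₁ E₂ : Type*} [NormedAddCommGroup E₁] [NormedSpace ℝ E₁]
  [FiniteDimensional ℝ E₁] [NormedAddCommGroup E₂] [NormedSpace ℝ E₂]

theorem thickening_image_prodMap_subset {L N : End ℝ E₁} {M : End ℝ E₂} {K R r : ℝ}
    (hK : 1 ≤ K) (hLN : L * N = 1) (hN : ∀ x, ‖N x‖ ≤ K * ‖x‖) (hM : ∀ x, ‖M x‖ ≤ K * ‖x‖)
    (hr : 0 ≤ r) :
    thickening r (L.prodMap M '' closedBall 0 R) ⊆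
      (L '' closedBall 0 (K * (R + r))) ×ˢ closedBall 0 (K * (R + r)) := by
  rintro ⟨y₁, y₂⟩ hy
  obtain ⟨_, ⟨⟨x₁, x₂⟩, hx, rfl⟩, hyx⟩ := mem_thickening_iff.1 hy
  have hx₁ : ‖x₁‖ ≤ R := (norm_fst_le _).trans (mem_closedBall_zero_iff.1 hx)
  have hx₂ : ‖x₂‖ ≤ R := (norm_snd_le _).trans (mem_closedBall_zero_iff.1 hx)
  rw [Prod.dist_eq, max_lt_iff, dist_eq_norm, dist_eq_norm] at hyx
  have hR : 0 ≤ R := (norm_nonneg x₁).trans hx₁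
  have hNL (x : E₁) : N (L x) = x := LinearMap.congr_fun (mul_eq_one_comm.1 hLN) x
  refine ⟨⟨N y₁, mem_closedBall_zero_iff.2 ?_, LinearMap.congr_fun hLN y₁⟩,
    mem_closedBall_zero_iff.2 ?_⟩
  · calc ‖N y₁‖ = ‖x₁ + N (y₁ - L x₁)‖ := by rw [map_sub, hNL, add_sub_cancel]
      _ ≤ R + K * r := by
          refine (norm_add_le _ _).trans (add_le_add hx₁ ((hN _).trans ?_))
          gcongr
          exact hyx.1.le
      _ ≤ K * (R + r) := by nlinarith
  · calc ‖y₂‖ = ‖M x₂ + (y₂ - M x₂)‖ := by rw [add_sub_cancel]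
      _ ≤ K * R + r := by
          refine (norm_add_le _ _).trans (add_le_add ((hM _).trans ?_) hyx.2.le)
          gcongr
      _ ≤ K * (R + r) := by nlinarith

variable [FiniteDimensional ℝ E₂]

theorem addHaar_thickening_image_prodMap_le [MeasurableSpace E₁] [BorelSpace E₁]
    [MeasurableSpace E₂] (μ : Measure E₁) [μ.IsAddHaarMeasure]
    (ν : Measure E₂) [ν.IsAddHaarMeasure] {L N : End ℝ E₁} {M : End ℝ E₂} {K R r : ℝ}
    (hK : 1 ≤ K) (hLN : L * N = 1) (hN : ∀ x, ‖N x‖ ≤ K * ‖x‖) (hM : ∀ x, ‖M x‖ ≤ K * ‖x‖)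
    (hr : 0 ≤ r) :
    (μ.prod ν) (thickening r (L.prodMap M '' closedBall 0 R)) ≤
      ENNReal.ofReal |LinearMap.det L| *
        (μ.prod ν) (closedBall 0 (K * (R + r))) := by
  refine (measure_mono (thickening_image_prodMap_subset hK hLN hN hM hr)).trans_eq ?_
  rw [Measure.prod_prod, Measure.addHaar_image_linearMap, mul_assoc, ← Measure.prod_prod,
    closedBall_prod_same, Prod.mk_zero_zero]

theorem exists_finset_subset_card_le_norm_prodMap_le {R r : ℝ} (hR : 0 ≤ R) (hr : 0 < r)
    {L N : End ℝ E₁} {M : End ℝ E₂} {K : ℝ} (hK : 1 ≤ K)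
    (hLN : L * N = 1) (hN : ∀ x, ‖N x‖ ≤ K * ‖x‖) (hM : ∀ x, ‖M x‖ ≤ K * ‖x‖)
    {s : Set (E₁ × E₂)} (hs : s ⊆ closedBall 0 R) :
    ∃ F : Finset (E₁ × E₂), ↑F ⊆ s ∧
      F.card ≤ |LinearMap.det L| * (K * (R + r) / r) ^ finrank ℝ (E₁ × E₂) ∧
      ∀ x ∈ s, ∃ c ∈ F, ‖L.prodMap M (x - c)‖ ≤ 2 * r := by
  classical
  borelize E₁ E₂
  let μ : Measure (E₁ × E₂) := Measure.addHaar.prod Measure.addHaar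
  let g : E₁ × E₂ →ₗ[ℝ] E₁ × E₂ := L.prodMap M
  obtain ⟨F, hFs, hF, hF_card⟩ := exists_finset_dist_le_and_card_mul_addHaar_ball_le μ
    (W := g '' s) ((isBounded_closedBall.subset hs).image g.toContinuousLinearMap) hr
  have h_preimage : ∀ y ∈ F, ∃ x ∈ s, g x = y := fun y hy => hFs hy
  choose! p hp_mem hp using h_preimage
  refine ⟨F.image p, ?_, ?_, fun x hx => ?_⟩
  · rw [Finset.coe_image]
    exact Set.image_subset_iff.2 hp_mem
  · have h_vol : μ (thickening r (g '' s)) ≤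
        ENNReal.ofReal |LinearMap.det L| * μ (closedBall 0 (K * (R + r))) :=
      (measure_mono (thickening_subset_of_subset r (Set.image_mono hs))).trans
        (addHaar_thickening_image_prodMap_le Measure.addHaar Measure.addHaar hK hLN hN hM hr.le)
    exact (Nat.cast_le.2 Finset.card_image_le).trans (natCast_le_of_mul_addHaar_ball_le μ
      (abs_nonneg _) (by positivity) hr (hF_card.trans h_vol))
  · obtain ⟨c, hc, hxc⟩ := hF (g x) (Set.mem_image_of_mem g hx)
    refine ⟨p c, Finset.mem_image_of_mem p hc, ?_⟩
    change ‖g (x - p c)‖ ≤ 2 * r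
    rwa [map_sub, hp c hc, ← dist_eq_norm]

end ProdMap

variable {V : Type*} [NormedAddCommGroup V] [NormedSpace ℝ V] [FiniteDimensional ℝ V]

theorem UnstableSplitting.exists_inverse_pow_bound {f : End ℝ V} (P : UnstableSplitting f) {η : ℝ}
    (hη : 1 < η) : ∃ (N : End ℝ P.unstable) (C : ℝ), P.unstableMap * N = 1 ∧ 1 ≤ C ∧
      (∀ (T : ℕ) x, ‖(N ^ T) x‖ ≤ C * η ^ T * ‖x‖) ∧
        ∀ (T : ℕ) x, ‖(P.stableMap ^ T) x‖ ≤ C * η ^ T * ‖x‖ := by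
  let e := P.unstableMap.equivOfDetNeZero P.det_unstableMap_ne_zero
  have h_inverse : P.unstableMap * e.symm.toLinearMap = 1 := LinearMap.ext e.apply_symm_apply
  have norm_inverse_le : ∀ z ∈ (e.symm : End ℝ P.unstable).charpoly.aroots ℂ, ‖z‖ ≤ 1 := by
    intro z hz
    have h_inv := P.one_lt_norm z⁻¹ (inv_mem_aroots_charpoly h_inverse hz)
    rw [norm_inv] at h_inv
    exact (one_lt_inv_iff₀.1 h_inv).2.le
  obtain ⟨C₁, hC₁⟩ := exists_norm_pow_apply_le norm_inverse_le zero_le_one hη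
  obtain ⟨C₂, hC₂⟩ := exists_norm_pow_apply_le P.norm_le_one zero_le_one hη
  have : 0 ≤ η := zero_le_one.trans hη.le
  refine ⟨e.symm, max 1 (max C₁ C₂), h_inverse, le_max_left _ _, fun T x => (hC₁ T x).trans ?_,
    fun T x => (hC₂ T x).trans ?_⟩
  · gcongr
    exact (le_max_left _ _).trans (le_max_right _ _)
  · gcongr
    exact (le_max_right _ _).trans (le_max_right _ _)

theorem exists_one_lt_mul_pow_lt {a b : ℝ} (hab : a < b) (k : ℕ) : ∃ η > 1, a * η ^ k < b := by
  have h_continuous : ContinuousAt (fun η : ℝ => a * η ^ k) 1 := by fun_prop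
  have h_nhds : ∀ᶠ η in nhdsWithin 1 (Set.Ioi 1), a * η ^ k < b :=
    nhdsWithin_le_nhds (h_continuous.eventually_lt_const (by simpa using hab))
  obtain ⟨η, hη, hη1⟩ := (h_nhds.and self_mem_nhdsWithin).exists
  exact ⟨η, hη1, hη⟩

theorem UnstableSplitting.exists_finset_subset_norm_prodMap_pow_le {f : End ℝ V}
    (P : UnstableSplitting f) {γ R r : ℝ} (hγ : unstableDet f < γ) (hR : 0 ≤ R) (hr : 0 < r) :
    ∃ C : ℝ, ∀ (T : ℕ) (s : Set (P.unstable × P.stable)), s ⊆ closedBall 0 R →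
      ∃ F : Finset (P.unstable × P.stable), ↑F ⊆ s ∧ F.card ≤ C * γ ^ T ∧
        ∀ x ∈ s, ∃ c ∈ F, ‖(P.unstableMap ^ T).prodMap (P.stableMap ^ T) (x - c)‖ ≤ r := by
  let D := finrank ℝ (P.unstable × P.stable)
  obtain ⟨η, hη, hηγ⟩ := exists_one_lt_mul_pow_lt hγ D
  obtain ⟨N, C, hN_mul, hC, hN, hM⟩ := P.exists_inverse_pow_bound hη
  refine ⟨(C * (R + r / 2) / (r / 2)) ^ D, fun T s hs => ?_⟩
  obtain ⟨F, hF_subset, hF_card, hF⟩ := exists_finset_subset_card_le_norm_prodMap_le hR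
    (half_pos hr) (one_le_mul_of_one_le_of_one_le hC (one_le_pow₀ hη.le))
    (pow_mul_pow_eq_one T hN_mul) (hN T) (hM T) hs
  refine ⟨F, hF_subset, ?_, by rwa [mul_div_cancel₀ r two_ne_zero] at hF⟩
  have h_rearrange : C * η ^ T * (R + r / 2) / (r / 2) =
      C * (R + r / 2) / (r / 2) * η ^ T := by ring
  calc (F.card : ℝ) ≤ |LinearMap.det (P.unstableMap ^ T)| *
        (C * η ^ T * (R + r / 2) / (r / 2)) ^ D := hF_card
    _ = (C * (R + r / 2) / (r / 2)) ^ D * (unstableDet f * η ^ D) ^ T := by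
        rw [map_pow, abs_pow, P.abs_det_unstableMap, h_rearrange, mul_pow _ (η ^ T),
          mul_pow (unstableDet f), pow_right_comm, mul_left_comm]
    _ ≤ (C * (R + r / 2) / (r / 2)) ^ D * γ ^ T := by
        have := one_le_unstableDet f
        gcongr

theorem exists_finset_card_le_norm_pow_apply_le {f : End ℝ V} {γ r : ℝ} (hγ : unstableDet f < γ)
    (hr : 0 < r) :
    ∃ C : ℝ, ∀ T : ℕ, ∃ F : Finset V, F.card ≤ C * γ ^ T ∧ (∀ c ∈ F, ‖c‖ ≤ 1) ∧
      ∀ y : V, ‖y‖ ≤ 1 → ∃ c ∈ F, ‖(f ^ T) (y - c)‖ ≤ r := by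
  obtain ⟨P⟩ := nonempty_unstableSplitting f
  let e := P.coords.toContinuousLinearEquiv
  obtain ⟨R, hR, he⟩ := e.toContinuousLinearMap.bound
  obtain ⟨R', hR', he'⟩ := e.symm.toContinuousLinearMap.bound
  obtain ⟨C, hC⟩ := P.exists_finset_subset_norm_prodMap_pow_le hγ hR.le (div_pos hr hR')
  refine ⟨C, fun T => ?_⟩
  have h_subset : e '' closedBall 0 1 ⊆ closedBall 0 R := by
    rintro _ ⟨y, hy, rfl⟩
    rw [mem_closedBall_zero_iff] at hy ⊢
    exact (he y).trans (mul_le_of_le_one_right hR.le hy)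
  obtain ⟨F, hF_subset, hF_card, hF⟩ := hC T _ h_subset
  refine ⟨F.map e.symm.toEquiv.toEmbedding, by rwa [Finset.card_map], fun c hc => ?_,
    fun y hy => ?_⟩
  · obtain ⟨x, hx, rfl⟩ := Finset.mem_map.1 hc
    obtain ⟨y, hy, rfl⟩ := hF_subset hx
    change ‖e.symm (e y)‖ ≤ 1
    rwa [e.symm_apply_apply, ← mem_closedBall_zero_iff]
  · obtain ⟨c, hc, hyc⟩ := hF (e y) ⟨y, mem_closedBall_zero_iff.2 hy, rfl⟩
    refine ⟨e.symm c, Finset.mem_map_of_mem _ hc, ?_⟩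
    have h_coords : e ((f ^ T) (y - e.symm c)) =
        (P.unstableMap ^ T).prodMap (P.stableMap ^ T) (e y - c) := by
      conv_rhs => rw [← e.apply_symm_apply c, ← map_sub]
      exact P.coords_pow_apply T _
    calc ‖(f ^ T) (y - e.symm c)‖ = ‖e.symm (e ((f ^ T) (y - e.symm c)))‖ := by
          rw [e.symm_apply_apply]
      _ ≤ R' * (r / R') := by
          rw [h_coords]
          exact (he' _).trans (by gcongr)
      _ = r := mul_div_cancel₀ r hR'.ne'

end Covering

section LowerBound

open MeasureTheory Module

theorem abs_det_le_card_of_subset_iUnion_preimage {E ι : Type*} [NormedAddCommGroup E]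
    [NormedSpace ℝ E] [FiniteDimensional ℝ E] [MeasurableSpace E] [BorelSpace E] {μ : Measure E}
    [μ.IsAddHaarMeasure] {W : Set E} (hW₀ : μ W ≠ 0) (hW : μ W ≠ ⊤) {L : End ℝ E} {S : Finset ι}
    {b : ι → E} (hS : W ⊆ ⋃ i ∈ S, (fun x => L x + b i) ⁻¹' W) : |LinearMap.det L| ≤ S.card := by
  rcases eq_or_ne (LinearMap.det L) 0 with hL | hL
  · rw [hL, abs_zero]
    exact Nat.cast_nonneg _
  have measure_piece (i : ι) : μ ((fun x => L x + b i) ⁻¹' W) =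
      ENNReal.ofReal |LinearMap.det L|⁻¹ * μ W := by
    rw [← abs_inv, ← measure_preimage_add_right μ (b i) W,
      ← Measure.addHaar_preimage_linearMap μ hL]
    rfl
  have h_measure : 1 * μ W ≤ S.card * ENNReal.ofReal |LinearMap.det L|⁻¹ * μ W :=
    calc 1 * μ W ≤ ∑ i ∈ S, μ ((fun x => L x + b i) ⁻¹' W) :=
          (one_mul _).trans_le ((measure_mono hS).trans (measure_biUnion_finset_le S _))
      _ = S.card * ENNReal.ofReal |LinearMap.det L|⁻¹ * μ W := by
          simp only [measure_piece, Finset.sum_const, nsmul_eq_mul, mul_assoc]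
  rwa [ENNReal.mul_le_mul_iff_left hW₀ hW, ← ENNReal.ofReal_natCast,
    ← ENNReal.ofReal_mul (Nat.cast_nonneg _), ENNReal.one_le_ofReal, ← div_eq_mul_inv,
    one_le_div (abs_pos.2 hL)] at h_measure

theorem unstableDet_pow_le_card {V ι : Type*} [NormedAddCommGroup V] [NormedSpace ℝ V]
    [FiniteDimensional ℝ V] (f : End ℝ V) {Q : Set V} (hQ : IsCompact Q)
    (hQ_int : (interior Q).Nonempty) {t : ℕ} {S : Finset ι} {b : ι → V}
    (hS : ∀ x ∈ Q, ∃ i ∈ S, (f ^ t) x + b i ∈ Q) : unstableDet f ^ t ≤ S.card := by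
  obtain ⟨P⟩ := nonempty_unstableSplitting f
  borelize ↥P.unstable
  let π : V →ₗ[ℝ] P.unstable := LinearMap.fst ℝ _ _ ∘ₗ P.coords.toLinearMap
  have π_pow (x : V) : π ((f ^ t) x) = (P.unstableMap ^ t) (π x) :=
    congrArg Prod.fst (P.coords_pow_apply t x)
  have π_surjective : Function.Surjective π :=
    Prod.fst_surjective.comp P.coords.surjective
  have h_pos : Measure.addHaar (π '' Q) ≠ 0 :=
    (((π.isOpenMap_of_finiteDimensional π_surjective _ isOpen_interior).measure_pos _
      (hQ_int.image π)).trans_le (measure_mono (Set.image_mono interior_subset))).ne'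
  have h_finite : Measure.addHaar (π '' Q) ≠ ⊤ :=
    (hQ.image π.continuous_of_finiteDimensional).measure_ne_top
  rw [← P.abs_det_unstableMap, ← abs_pow, ← map_pow]
  refine abs_det_le_card_of_subset_iUnion_preimage h_pos h_finite (b := π ∘ b) ?_
  rintro _ ⟨x, hx, rfl⟩
  obtain ⟨i, hi, hiQ⟩ := hS x hx
  refine Set.mem_iUnion₂.2 ⟨i, hi, _, hiQ, ?_⟩
  rw [map_add, π_pow, Function.comp_apply]

end LowerBound

section Perturbation

open Filter Topology Pointwise Metric

theorem exists_forall_exists_closedBall_subset {X X' F : Type*} [TopologicalSpace X]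
    [TopologicalSpace X'] [PseudoMetricSpace F] {f : X → F → X'} (hf_left : ∀ u, Continuous (f · u))
    (hf_right : ∀ x, Continuous (f x)) {Q : Set X} (hQ : IsCompact Q) {U : Set F}
    (hU : U ⊆ closure (interior U)) {O : Set X'} (hO : IsOpen O)
    (h_steer : ∀ x ∈ Q, ∃ u ∈ U, f x u ∈ O) :
    ∃ δ > 0, ∀ x ∈ Q, ∃ u, closedBall u δ ⊆ U ∧ f x u ∈ O := by
  have h_interior (x : X) (hx : x ∈ Q) : ∃ u ∈ interior U, f x u ∈ O := by
    obtain ⟨u, hu, hxu⟩ := h_steer x hx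
    obtain ⟨w, hwO, hwU⟩ := mem_closure_iff.1 (hU hu) _ (hO.preimage (hf_right x)) hxu
    exact ⟨w, hwU, hwO⟩
  choose w hwU hwO using h_interior
  obtain ⟨P, hP⟩ := hQ.elim_nhds_subcover' (fun x hx => (f · (w x hx)) ⁻¹' O) fun x hx =>
    (hO.preimage (hf_left (w x hx))).mem_nhds (hwO x hx)
  have h_ball : ∀ᶠ δ in 𝓝 0, ∀ x ∈ P, closedBall (w x x.2) δ ⊆ U :=
    P.eventually_all.2 fun x _ =>
      eventually_closedBall_subset (mem_interior_iff_mem_nhds.1 (hwU x x.2))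
  obtain ⟨δ, hδU, hδ⟩ :=
    ((h_ball.filter_mono nhdsWithin_le_nhds).and (self_mem_nhdsWithin (s := Set.Ioi 0))).exists
  refine ⟨δ, hδ, fun x hx => ?_⟩
  obtain ⟨c, hc, hxc⟩ := Set.mem_iUnion₂.1 (hP hx)
  exact ⟨w c c.2, hδU c hc, hxc⟩

variable {E : Type*} [NormedAddCommGroup E] [NormedSpace ℝ E]

theorem exists_lt_one_subset_smul_of_thickening_subset {D K : Set E} (hK : Bornology.IsBounded K)
    {ρ : ℝ} (hρ : 0 < ρ) (hKD : thickening ρ K ⊆ D) :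
    ∃ θ : ℝ, 0 < θ ∧ θ < 1 ∧ K ⊆ θ • D := by
  obtain ⟨R, hR⟩ := hK.exists_norm_le
  have h_lim : Tendsto (fun θ : ℝ => ‖θ⁻¹ - 1‖ * R) (𝓝 1) (𝓝 0) := by
    have : ContinuousAt (fun θ : ℝ => ‖θ⁻¹ - 1‖ * R) 1 := by fun_prop (disch := exact one_ne_zero)
    simpa [ContinuousAt] using this
  obtain ⟨θ, hθ, hθ₀, hθ₁⟩ := (((h_lim.eventually_lt_const hρ).filter_mono
    nhdsWithin_le_nhds).and (Ioo_mem_nhdsLT one_pos)).exists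
  refine ⟨θ, hθ₀, hθ₁, fun x hx => (Set.mem_smul_set_iff_inv_smul_mem₀ hθ₀.ne' D x).2
    (hKD (mem_thickening_iff.2 ⟨x, hx, ?_⟩))⟩
  calc dist (θ⁻¹ • x) x = ‖θ⁻¹ - 1‖ * ‖x‖ := by rw [dist_eq_norm, ← norm_smul, sub_smul, one_smul]
    _ ≤ ‖θ⁻¹ - 1‖ * R := by gcongr; exact hR x hx
    _ < ρ := hθ

theorem thickening_convexHull_subset (s : Set E) (ρ : ℝ) :
    thickening ρ (convexHull ℝ s) ⊆ convexHull ℝ (thickening ρ s) := by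
  rw [← add_ball_zero, ← add_ball_zero, convexHull_add, (convex_ball 0 ρ).convexHull_eq]

end Perturbation

namespace ControlSystem

section Transition

variable {X U : Type*} [TopologicalSpace X] (C : ControlSystem X U)

theorem continuous_transition (ω : ℕ → U) (k : ℕ) : Continuous (C.transition ω k) := by
  induction k with
  | zero => exact continuous_id
  | succ k ih => exact (C.continuous_f (ω k)).comp ih

theorem transition_congr {ω ω' : ℕ → U} {k : ℕ} (h : ∀ j < k, ω j = ω' j) (x : X) :
    C.transition ω k x = C.transition ω' k x := by
  induction k with
  | zero => rfl
  | succ k ih =>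
    rw [transition, transition, ih fun j hj => h j (hj.trans k.lt_succ_self), h k k.lt_succ_self]

theorem transition_add (ω : ℕ → U) (T k : ℕ) (x : X) :
    C.transition ω (T + k) x = C.transition (fun j => ω (T + j)) k (C.transition ω T x) := by
  induction k with
  | zero => rfl
  | succ k ih => rw [← add_assoc, transition, ih, transition]

/-- The control sequence that follows `ω` up to time `T` and `ω'` from then on. -/
def concat (ω : ℕ → U) (T : ℕ) (ω' : ℕ → U) (k : ℕ) : U :=
  if k < T then ω k else ω' (k - T)

theorem transition_concat_of_le (ω ω' : ℕ → U) {T k : ℕ} (hk : k ≤ T) (x : X) :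
    C.transition (concat ω T ω') k x = C.transition ω k x :=
  C.transition_congr (fun _ hj => if_pos (hj.trans_le hk)) x

theorem transition_concat_add (ω ω' : ℕ → U) (T k : ℕ) (x : X) :
    C.transition (concat ω T ω') (T + k) x = C.transition ω' k (C.transition ω T x) := by
  rw [transition_add, C.transition_concat_of_le ω ω' le_rfl]
  congr 1
  funext j
  simp [concat]

theorem exists_forall_transition_mem {V : Set U} {s : ℕ → Set X}
    (hs : ∀ k, ∀ x ∈ s k, ∃ u ∈ V, C.f x u ∈ s (k + 1)) {x : X} (hx : x ∈ s 0) :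
    ∃ ω : ℕ → U, (∀ k, ω k ∈ V) ∧ ∀ k, C.transition ω k x ∈ s k := by
  choose u hu hu_mem using hs
  let y (k : ℕ) : s k := k.rec ⟨x, hx⟩ fun k z => ⟨_, hu_mem k z z.2⟩
  let ω (k : ℕ) : U := u k (y k).1 (y k).2
  have y_eq_transition (k : ℕ) : (y k).1 = C.transition ω k x := by
    induction k with
    | zero => rfl
    | succ k ih => rw [transition, ← ih]
  exact ⟨ω, fun k => hu k _ _, fun k => y_eq_transition k ▸ (y k).2⟩

end Transition

section Network

variable {ι : Type*} {X U : ι → Type*} [∀ i, TopologicalSpace (X i)]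
  (C : ∀ i, ControlSystem (X i) (U i))

theorem transition_network_apply (ω : ℕ → ∀ i, U i) (k : ℕ) (x : ∀ i, X i) (i : ι) :
    (network C).transition ω k x i = (C i).transition (fun j => ω j i) k (x i) := by
  induction k with
  | zero => rfl
  | succ k ih =>
    rw [transition, transition, ← ih]
    rfl

variable {C}

theorem StronglyInvariant.image_eval {Q : Set (∀ i, X i)} (hQ : (network C).StronglyInvariant Q)
    (i : ι) : (C i).StronglyInvariant (Function.eval i '' Q) := by
  obtain ⟨K, hK, hKQ, h_steer⟩ := hQ
  have h_open : IsOpenMap (Function.eval i : (∀ i, X i) → X i) := isOpenMap_eval i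
  refine ⟨Function.eval i '' K, hK.image (continuous_apply i),
    (Set.image_mono hKQ).trans (h_open.image_interior_subset Q), ?_⟩
  rintro _ ⟨x, hx, rfl⟩
  obtain ⟨u, hu⟩ := h_steer x hx
  exact ⟨u i, h_open.image_interior_subset K ⟨_, hu, rfl⟩⟩

end Network

section Unconstrained

variable {E F : Type*} [NormedAddCommGroup E] [NormedSpace ℝ E] [FiniteDimensional ℝ E]
  [AddCommGroup F] [Module ℝ F]

/-- The linear system `x_{k+1} = A x_k + B u_k` with controls ranging over a whole vector space, so
that its trajectories can be superposed. -/
def unconstrained (A : Module.End ℝ E) (B : F →ₗ[ℝ] E) : ControlSystem E F where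
  f x u := A x + B u
  continuous_f _ := A.continuous_of_finiteDimensional.add continuous_const

theorem transition_linear {d m : ℕ} (A : Matrix (Fin d) (Fin d) ℝ) (B : Matrix (Fin d) (Fin m) ℝ)
    {U : Set (Fin m → ℝ)} (ω : ℕ → U) (k : ℕ) (x : Fin d → ℝ) :
    (linear A B U).transition ω k x =
      (unconstrained (Matrix.toLin' A) (Matrix.toLin' B)).transition (fun j => ω j) k x := by
  induction k with
  | zero => rfl
  | succ k ih =>
    rw [transition, ih]
    rfl

variable (A : Module.End ℝ E) (B : F →ₗ[ℝ] E)

theorem transition_unconstrained_add (v w : ℕ → F) (k : ℕ) (x y : E) :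
    (unconstrained A B).transition (v + w) k (x + y) =
      (unconstrained A B).transition v k x + (unconstrained A B).transition w k y := by
  induction k with
  | zero => rfl
  | succ k ih =>
    simp only [transition, unconstrained] at ih ⊢
    rw [ih, Pi.add_apply, map_add, map_add, add_add_add_comm]

theorem transition_unconstrained_smul (a : ℝ) (v : ℕ → F) (k : ℕ) (x : E) :
    (unconstrained A B).transition (a • v) k (a • x) =
      a • (unconstrained A B).transition v k x := by
  induction k with
  | zero => rfl
  | succ k ih =>
    simp only [transition, unconstrained] at ih ⊢
    rw [ih, Pi.smul_apply, map_smul, map_smul, smul_add]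

theorem transition_unconstrained_zero (k : ℕ) (x : E) :
    (unconstrained A B).transition 0 k x = (A ^ k) x := by
  induction k with
  | zero => rfl
  | succ k ih =>
    rw [transition, ih, pow_succ']
    simp [unconstrained]

theorem transition_unconstrained_add_left (v : ℕ → F) (k : ℕ) (x y : E) :
    (unconstrained A B).transition v k (x + y) =
      (A ^ k) x + (unconstrained A B).transition v k y := by
  rw [← transition_unconstrained_zero A B, ← transition_unconstrained_add, zero_add]

end Unconstrained

section Steering

open Filter Topology Pointwise

variable {E F : Type*} [NormedAddCommGroup E] [NormedSpace ℝ E] [AddCommGroup F] [Module ℝ F]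
  {A : Module.End ℝ E} {B : F →ₗ[ℝ] E}

theorem exists_steer_sub {Q K : Set E} (h_steer : ∀ x ∈ Q, ∃ u, A x + B u ∈ K) {x : E}
    (hx : x ∈ Q - Q) : ∃ u, A x + B u ∈ K - K := by
  obtain ⟨y, hy, z, hz, rfl⟩ := hx
  obtain ⟨u, hu⟩ := h_steer y hy
  obtain ⟨v, hv⟩ := h_steer z hz
  refine ⟨u - v, ?_⟩
  rw [map_sub, map_sub, sub_add_sub_comm]
  exact Set.sub_mem_sub hu hv

theorem exists_steer_convexHull {Q K : Set E} (h_steer : ∀ x ∈ Q, ∃ u, A x + B u ∈ K) {x : E}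
    (hx : x ∈ convexHull ℝ Q) : ∃ u, A x + B u ∈ convexHull ℝ K := by
  suffices h : convexHull ℝ Q ⊆ {x | ∃ u, A x + B u ∈ convexHull ℝ K} from h hx
  refine convexHull_min (fun x hx => ?_) ?_
  · obtain ⟨u, hu⟩ := h_steer x hx
    exact ⟨u, subset_convexHull ℝ K hu⟩
  · rintro x ⟨u, hu⟩ y ⟨v, hv⟩ a b ha hb hab
    refine ⟨a • u + b • v, ?_⟩
    have h_combination : A (a • x + b • y) + B (a • u + b • v) =
        a • (A x + B u) + b • (A y + B v) := by
      simp only [map_add, map_smul, smul_add, add_add_add_comm]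
    rw [h_combination]
    exact convex_convexHull ℝ K hu hv ha hb hab

theorem exists_steer_smul_of_steer_interior {Q K : Set E} (hQ : IsCompact Q)
    (hQ_int : (interior Q).Nonempty) (hK : IsCompact K) (hKQ : K ⊆ interior Q)
    (h_steer : ∀ x ∈ Q, ∃ u, A x + B u ∈ K) :
    ∃ D ∈ 𝓝 (0 : E), Bornology.IsBounded D ∧ ∃ θ : ℝ, 0 < θ ∧ θ < 1 ∧
      ∀ x ∈ D, ∃ u, A x + B u ∈ θ • D := by
  have h_sub_interior : K - K ⊆ interior (Q - Q) :=
    (Set.sub_subset_sub hKQ (hKQ.trans interior_subset)).trans subset_interior_sub_left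
  have isCompact_sub_self {s : Set E} (hs : IsCompact s) : IsCompact (s - s) :=
    sub_eq_add_neg s s ▸ hs.add hs.neg
  obtain ⟨ρ, hρ, hρQ⟩ := (isCompact_sub_self hK).exists_thickening_subset_open isOpen_interior
    h_sub_interior
  obtain ⟨θ, hθ₀, hθ₁, hθ⟩ := exists_lt_one_subset_smul_of_thickening_subset
    (isBounded_convexHull.2 (isCompact_sub_self hK).isBounded) hρ
    ((thickening_convexHull_subset _ ρ).trans
      (convexHull_mono (hρQ.trans interior_subset)))
  refine ⟨convexHull ℝ (Q - Q), ?_, isBounded_convexHull.2 (isCompact_sub_self hQ).isBounded, θ,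
    hθ₀, hθ₁, fun x hx => ?_⟩
  · obtain ⟨z, hz⟩ := hQ_int
    exact mem_interior_iff_mem_nhds.1 (interior_mono (subset_convexHull ℝ _)
      (subset_interior_sub_left ⟨z, hz, z, interior_subset hz, sub_self z⟩))
  · obtain ⟨u, hu⟩ := exists_steer_convexHull (fun _ => exists_steer_sub h_steer) hx
    exact ⟨u, hθ hu⟩

variable [FiniteDimensional ℝ E]

/-- The states of the unit ball can be driven arbitrarily close to the origin at all sufficiently
large times, uniformly on the ball. The unit ball stands for all bounded sets, by homogeneity. -/
def UniformlyNullSteerable (A : Module.End ℝ E) (B : F →ₗ[ℝ] E) : Prop :=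
  ∀ ε > 0, ∀ᶠ T : ℕ in atTop, ∀ x, ‖x‖ ≤ 1 → ∃ v, ‖(unconstrained A B).transition v T x‖ ≤ ε

theorem uniformlyNullSteerable_of_steer_smul {D : Set E} (hD : D ∈ 𝓝 0)
    (hD_bdd : Bornology.IsBounded D) {θ : ℝ} (hθ₀ : 0 < θ) (hθ₁ : θ < 1)
    (h_steer : ∀ x ∈ D, ∃ u, A x + B u ∈ θ • D) : UniformlyNullSteerable A B := by
  intro ε hε
  obtain ⟨R, hR⟩ := hD_bdd.exists_norm_le
  obtain ⟨r, hr, hrD⟩ := Metric.nhds_basis_closedBall.mem_iff.1 hD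
  have h_lim : Tendsto (fun T : ℕ => θ ^ T * (r⁻¹ * R)) atTop (𝓝 0) := by
    simpa using (tendsto_pow_atTop_nhds_zero_of_lt_one hθ₀.le hθ₁).mul_const (r⁻¹ * R)
  filter_upwards [h_lim.eventually_le_const hε] with T hT x hx
  have h_step (k : ℕ) (y : E) (hy : y ∈ (θ ^ k * r⁻¹) • D) :
      ∃ u ∈ Set.univ, (unconstrained A B).f y u ∈ (θ ^ (k + 1) * r⁻¹) • D := by
    obtain ⟨z, hz, rfl⟩ := hy
    obtain ⟨u, y, hy, hyu⟩ := h_steer z hz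
    refine ⟨(θ ^ k * r⁻¹) • u, Set.mem_univ _, y, hy, ?_⟩
    simp only [unconstrained, map_smul, ← smul_add, ← hyu, smul_smul]
    congr 1
    ring
  have h_start : x ∈ (θ ^ 0 * r⁻¹) • D := by
    rw [pow_zero, one_mul, Set.mem_smul_set_iff_inv_smul_mem₀ (inv_ne_zero hr.ne'), inv_inv]
    refine hrD (mem_closedBall_zero_iff.2 ?_)
    rw [norm_smul_of_nonneg hr.le]
    exact mul_le_of_le_one_right hr.le hx
  obtain ⟨v, -, hv⟩ := exists_forall_transition_mem (unconstrained A B) h_step h_start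
  obtain ⟨z, hz, hzv⟩ := hv T
  refine ⟨v, ?_⟩
  rw [← hzv, norm_smul_of_nonneg (by positivity), mul_assoc]
  exact le_trans (by gcongr; exact hR z hz) hT

end Steering

theorem exists_finset_card_le_pow_transition_mem {X U : Type*} [TopologicalSpace X]
    (C : ControlSystem X U) {s O : Set X} {V : Set U} (hV : V.Nonempty) (hsO : s ⊆ O) {T : ℕ}
    {G : Finset (ℕ → U)}
    (hG : ∀ y ∈ s, ∃ g ∈ G, (∀ k < T, g k ∈ V) ∧ (∀ k ≤ T, C.transition g k y ∈ O) ∧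
      C.transition g T y ∈ s) (N : ℕ) :
    ∃ W : Finset (ℕ → U), W.card ≤ G.card ^ N ∧ ∀ y ∈ s, ∃ w ∈ W, (∀ k, w k ∈ V) ∧
      ∀ k ≤ N * T, C.transition w k y ∈ O := by
  classical
  induction N with
  | zero =>
    obtain ⟨u, hu⟩ := hV
    refine ⟨{fun _ => u}, by simp, fun y hy => ⟨_, Finset.mem_singleton_self _, fun _ => hu,
      fun k hk => ?_⟩⟩
    rw [Nat.le_zero.1 (hk.trans_eq (zero_mul T))]
    exact hsO hy
  | succ N ih =>
    obtain ⟨W, hW_card, hW⟩ := ih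
    refine ⟨(G ×ˢ W).image fun p => concat p.1 T p.2, ?_, fun y hy => ?_⟩
    · calc _ ≤ (G ×ˢ W).card := Finset.card_image_le
        _ = W.card * G.card := by rw [Finset.card_product, mul_comm]
        _ ≤ G.card ^ N * G.card := Nat.mul_le_mul_right _ hW_card
        _ = G.card ^ (N + 1) := (pow_succ _ _).symm
    obtain ⟨g, hg, hgV, hgO, hgs⟩ := hG y hy
    obtain ⟨w, hw, hwV, hwO⟩ := hW _ hgs
    refine ⟨_, Finset.mem_image_of_mem _ (Finset.mk_mem_product hg hw), fun k => ?_,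
      fun k hk => ?_⟩
    · rcases lt_or_ge k T with hkT | hkT
      · rw [concat, if_pos hkT]
        exact hgV k hkT
      · rw [concat, if_neg hkT.not_gt]
        exact hwV _
    · rcases le_total k T with hkT | hkT
      · rw [transition_concat_of_le _ _ _ hkT]
        exact hgO k hkT
      · obtain ⟨j, rfl⟩ := Nat.exists_eq_add_of_le hkT
        rw [transition_concat_add]
        exact hwO j (by linarith [add_one_mul N T])

section ReturnWords

open Filter Topology Metric

variable {E F : Type*} [NormedAddCommGroup E] [NormedSpace ℝ E] [FiniteDimensional ℝ E]

theorem exists_finset_card_le_norm_transition_le_one [AddCommGroup F] [Module ℝ F]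
    {A : Module.End ℝ E} {B : F →ₗ[ℝ] E} {γ : ℝ} (hγ : unstableDet A < γ)
    (h_steer : UniformlyNullSteerable A B) :
    ∃ T : ℕ, 0 < T ∧ ∃ G : Finset (ℕ → F), G.card ≤ γ ^ T ∧
      ∀ y, ‖y‖ ≤ 1 → ∃ g ∈ G, ‖(unconstrained A B).transition g T y‖ ≤ 1 := by
  classical
  obtain ⟨γ', hγ', hγ'γ⟩ := exists_between hγ
  have hγ'_pos : 0 < γ' := (one_pos.trans_le (one_le_unstableDet A)).trans hγ'
  obtain ⟨C, hC⟩ := exists_finset_card_le_norm_pow_apply_le hγ' one_half_pos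
  obtain ⟨T, hT_steer, hT_rate, hT_pos⟩ :=
    ((h_steer _ one_half_pos).and ((eventually_mul_pow_le_pow hγ'_pos hγ'γ C).and
      (eventually_gt_atTop 0))).exists
  obtain ⟨P, hP_card, hP_norm, hP⟩ := hC T
  choose! v hv using hT_steer
  refine ⟨T, hT_pos, P.image v, ?_, fun y hy => ?_⟩
  · calc ((P.image v).card : ℝ) ≤ P.card := Nat.cast_le.2 Finset.card_image_le
      _ ≤ C * γ' ^ T := hP_card
      _ ≤ γ ^ T := hT_rate
  · obtain ⟨c, hc, hyc⟩ := hP y hy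
    refine ⟨v c, Finset.mem_image_of_mem v hc, ?_⟩
    calc ‖(unconstrained A B).transition (v c) T y‖
        = ‖(A ^ T) (y - c) + (unconstrained A B).transition (v c) T c‖ := by
          rw [← transition_unconstrained_add_left, sub_add_cancel]
      _ ≤ 1 / 2 + 1 / 2 := norm_add_le_of_le hyc (hv c (hP_norm c hc))
      _ = 1 := add_halves 1

variable [NormedAddCommGroup F] [NormedSpace ℝ F] {A : Module.End ℝ E} {B : F →ₗ[ℝ] E}

theorem eventually_norm_transition_le (g : ℕ → F) (T : ℕ) :
    ∀ᶠ M : ℝ in atTop, (∀ k < T, ‖g k‖ ≤ M) ∧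
      ∀ k ≤ T, ∀ y, ‖y‖ ≤ 1 → ‖(unconstrained A B).transition g k y‖ ≤ M := by
  refine .and ((Set.finite_Iio T).eventually_all.2 fun k _ => eventually_ge_atTop _)
    ((Set.finite_Iic T).eventually_all.2 fun k _ => ?_)
  obtain ⟨R, hR⟩ := (isCompact_closedBall (0 : E) 1).exists_bound_of_continuousOn
    ((unconstrained A B).continuous_transition g k).continuousOn
  filter_upwards [eventually_ge_atTop R] with M hM y hy
  exact (hR y (mem_closedBall_zero_iff.2 hy)).trans hM

theorem exists_finset_card_le_norm_transition_le {γ : ℝ} (hγ : unstableDet A < γ)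
    (h_steer : UniformlyNullSteerable A B) :
    ∃ C M : ℝ, 0 < M ∧ ∀ t : ℕ, ∃ V : Finset (ℕ → F), V.card ≤ C * γ ^ t ∧
      ∀ y, ‖y‖ ≤ 1 → ∃ v ∈ V, (∀ k, ‖v k‖ ≤ M) ∧
        ∀ k ≤ t, ‖(unconstrained A B).transition v k y‖ ≤ M := by
  obtain ⟨T, hT, G, hG_card, hG⟩ := exists_finset_card_le_norm_transition_le_one hγ h_steer
  obtain ⟨M, hM_one, hM⟩ := ((eventually_ge_atTop 1).and (G.eventually_all.2 fun g _ =>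
    eventually_norm_transition_le (A := A) (B := B) g T)).exists
  have hγ_one : 1 ≤ γ := (one_le_unstableDet A).trans hγ.le
  refine ⟨γ ^ T, M, one_pos.trans_le hM_one, fun t => ?_⟩
  obtain ⟨W, hW_card, hW⟩ := (unconstrained A B).exists_finset_card_le_pow_transition_mem
    (s := closedBall 0 1) (O := closedBall 0 M) (V := closedBall 0 M)
    (nonempty_closedBall.2 (zero_le_one.trans hM_one)) (closedBall_subset_closedBall hM_one)
    (T := T) (G := G) (by
      simp only [mem_closedBall_zero_iff]
      intro y hy
      obtain ⟨g, hg, hgy⟩ := hG y hy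
      exact ⟨g, hg, (hM g hg).1, fun k hk => (hM g hg).2 k hk y hy, hgy⟩) (t / T + 1)
  have ht_le : t ≤ (t / T + 1) * T := (Nat.lt_mul_of_div_lt (t / T).lt_succ_self hT).le
  refine ⟨W, ?_, fun y hy => ?_⟩
  · calc (W.card : ℝ) ≤ (G.card : ℝ) ^ (t / T + 1) := by exact_mod_cast hW_card
      _ ≤ (γ ^ T) ^ (t / T + 1) := by gcongr
      _ = γ ^ T * γ ^ (T * (t / T)) := by rw [← pow_mul, mul_add_one, pow_add, mul_comm]
      _ ≤ γ ^ T * γ ^ t := by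
          gcongr
          exact Nat.mul_div_le t T
  · simp only [mem_closedBall_zero_iff] at hW
    obtain ⟨w, hw, hw_norm, hw_transition⟩ := hW y hy
    exact ⟨w, hw, hw_norm, fun k hk => hw_transition k (hk.trans ht_le)⟩

theorem exists_finset_card_le_norm_transition_le_of_pos {γ ρ : ℝ} (hγ : unstableDet A < γ)
    (h_steer : UniformlyNullSteerable A B) (hρ : 0 < ρ) :
    ∃ r > 0, ∃ C : ℝ, ∀ t : ℕ, ∃ V : Finset (ℕ → F), V.card ≤ C * γ ^ t ∧
      ∀ y, ‖y‖ ≤ r → ∃ v ∈ V, (∀ k, ‖v k‖ ≤ ρ) ∧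
        ∀ k ≤ t, ‖(unconstrained A B).transition v k y‖ ≤ ρ := by
  classical
  obtain ⟨C, M, hM, hC⟩ := exists_finset_card_le_norm_transition_le hγ h_steer
  have hr : 0 < ρ / M := div_pos hρ hM
  have scaled_le {a : ℝ} (ha : a ≤ M) : ρ / M * a ≤ ρ :=
    (mul_le_mul_of_nonneg_left ha hr.le).trans_eq (div_mul_cancel₀ ρ hM.ne')
  refine ⟨ρ / M, hr, C, fun t => ?_⟩
  obtain ⟨V, hV_card, hV⟩ := hC t
  refine ⟨V.image ((ρ / M) • ·), le_trans (Nat.cast_le.2 Finset.card_image_le) hV_card,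
    fun y hy => ?_⟩
  obtain ⟨v, hv, hv_norm, hv_transition⟩ := hV ((ρ / M)⁻¹ • y) (by
    rwa [norm_smul_of_nonneg (inv_nonneg.2 hr.le), inv_mul_le_one₀ hr])
  refine ⟨_, Finset.mem_image_of_mem _ hv, fun k => ?_, fun k hk => ?_⟩
  · rw [Pi.smul_apply, norm_smul_of_nonneg hr.le]
    exact scaled_le (hv_norm k)
  · rw [← smul_inv_smul₀ hr.ne' y, transition_unconstrained_smul, norm_smul_of_nonneg hr.le]
    exact scaled_le (hv_transition k hk)

end ReturnWords

section NominalControls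

open Metric

variable {ι : Type*} {d m : ι → ℕ} {A : ∀ i, Matrix (Fin (d i)) (Fin (d i)) ℝ}
  {B : ∀ i, Matrix (Fin (d i)) (Fin (m i)) ℝ} {U : ∀ i, Set (Fin (m i) → ℝ)}
  {Q : Set (∀ i, Fin (d i) → ℝ)}

theorem StronglyInvariant.exists_interior_controls [Finite ι]
    (hU : ∀ i, U i ⊆ closure (interior (U i))) (hQ : IsCompact Q)
    (hinv : (network fun i => linear (A i) (B i) (U i)).StronglyInvariant Q) :
    ∃ K : Set (∀ i, Fin (d i) → ℝ), IsCompact K ∧ K ⊆ interior Q ∧ ∃ δ > 0, ∀ x ∈ Q,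
      ∃ u ∈ {u : ∀ i, Fin (m i) → ℝ | ∀ i, closedBall (u i) δ ⊆ U i},
        (network fun i => unconstrained (A i).toLin' (B i).toLin').f x u ∈ K := by
  cases nonempty_fintype ι
  obtain ⟨K, hK, hKQ, h_steer⟩ := hinv
  have h_continuous (x : ∀ i, Fin (d i) → ℝ) :
      Continuous ((network fun i => unconstrained (A i).toLin' (B i).toLin').f x) :=
    continuous_pi fun i => continuous_const.add
      ((B i).toLin'.continuous_of_finiteDimensional.comp (continuous_apply i))
  have hU_pi : Set.univ.pi U ⊆ closure (interior (Set.univ.pi U)) := by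
    rw [interior_pi_set Set.finite_univ, closure_pi_set]
    exact Set.pi_mono fun i _ => hU i
  obtain ⟨δ, hδ, h⟩ := exists_forall_exists_closedBall_subset
    (continuous_f (network fun i => unconstrained (A i).toLin' (B i).toLin')) h_continuous hQ
    hU_pi (isOpen_interior (s := K)) fun x hx =>
      let ⟨u, hu⟩ := h_steer x hx
      ⟨fun i => u i, fun i _ => (u i).2, hu⟩
  refine ⟨K, hK, hKQ, δ, hδ, fun x hx => ?_⟩
  obtain ⟨u, hu_ball, hu⟩ := h x hx
  refine ⟨u, fun i => ?_, interior_subset hu⟩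
  rw [closedBall_pi u hδ.le, Set.univ_pi_subset_univ_pi_iff] at hu_ball
  exact hu_ball.resolve_right (fun ⟨j, hj⟩ => (nonempty_closedBall.2 hδ.le).ne_empty hj) i

theorem exists_nominal_controls [Fintype ι] (hU : ∀ i, U i ⊆ closure (interior (U i)))
    (hQ : IsCompact Q) (hinv : (network fun i => linear (A i) (B i) (U i)).StronglyInvariant Q) :
    ∃ ρ > 0, ∀ x ∈ Q, ∃ ω : ℕ → ∀ i, Fin (m i) → ℝ, (∀ k i, closedBall (ω k i) ρ ⊆ U i) ∧
      ∀ k, 1 ≤ k →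
        closedBall ((network fun i => unconstrained (A i).toLin' (B i).toLin').transition ω k x) ρ ⊆
          interior Q := by
  obtain ⟨K, hK, hKQ, δ, hδ, h_steer⟩ := hinv.exists_interior_controls hU hQ
  obtain ⟨ε, hε, hεQ⟩ := hK.exists_cthickening_subset_open isOpen_interior hKQ
  refine ⟨min δ ε, lt_min hδ hε, fun x hx => ?_⟩
  have h_step (k : ℕ) (y) (hy : y ∈ if k = 0 then Q else K) :=
    h_steer y (by
      split_ifs at hy
      exacts [hy, interior_subset (hKQ hy)])
  obtain ⟨ω, hωU, hωK⟩ := exists_forall_transition_mem _ h_step hx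
  refine ⟨ω, fun k i => (closedBall_subset_closedBall (min_le_left _ _)).trans (hωU k i),
    fun k hk => ?_⟩
  have hωkK := hωK k
  rw [if_neg (Nat.one_le_iff_ne_zero.1 hk)] at hωkK
  exact (closedBall_subset_closedBall (min_le_right _ _)).trans
    ((closedBall_subset_cthickening hωkK ε).trans hεQ)

theorem dist_transition_network_linear_le [Fintype ι] {ω : ℕ → ∀ i, Fin (m i) → ℝ}
    {v : ∀ i, ℕ → Fin (m i) → ℝ} {w : ℕ → ∀ i, U i}
    (hw : ∀ k i, (w k i : Fin (m i) → ℝ) = ω k i + v i k)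
    {x c : ∀ i, Fin (d i) → ℝ} {k : ℕ} {ρ : ℝ} (hρ : 0 ≤ ρ)
    (hv : ∀ i, ‖(unconstrained (A i).toLin' (B i).toLin').transition (v i) k (x i - c i)‖ ≤ ρ) :
    dist ((network fun i => linear (A i) (B i) (U i)).transition w k x)
      ((network fun i => unconstrained (A i).toLin' (B i).toLin').transition ω k c) ≤ ρ := by
  refine (dist_pi_le_iff hρ).2 fun i => ?_
  have h_control : (fun j => (w j i : Fin (m i) → ℝ)) = (fun j => ω j i) + v i :=
    funext fun j => hw j i
  rw [transition_network_apply, transition_network_apply, transition_linear, h_control,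
    ← add_sub_cancel (c i) (x i), transition_unconstrained_add, dist_eq_norm, add_sub_cancel_left]
  exact hv i

theorem card_preimage_image_add_le {T F : Type*} [AddCommGroup F] [DecidableEq (ℕ → F)] {U : Set F}
    (P : Finset T) (V : Finset (ℕ → F)) (ω : T → ℕ → F)
    (h_inj : Function.Injective fun (w : ℕ → U) k => (w k : F)) :
    (((P ×ˢ V).image fun p => ω p.1 + p.2).preimage _ h_inj.injOn).card ≤ P.card * V.card :=
  calc _ ≤ ((P ×ˢ V).image fun p => ω p.1 + p.2).card :=
        Finset.card_le_card_of_injOn _ (fun _ => Finset.mem_preimage.1) h_inj.injOn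
    _ ≤ (P ×ˢ V).card := Finset.card_image_le
    _ = P.card * V.card := Finset.card_product P V

theorem exists_isSpanning_card_le [Finite ι] (hU : ∀ i, U i ⊆ closure (interior (U i)))
    (hQ : IsCompact Q) (hinv : (network fun i => linear (A i) (B i) (U i)).StronglyInvariant Q)
    (h_steer : ∀ i, UniformlyNullSteerable (A i).toLin' (B i).toLin') {γ : ι → ℝ}
    (hγ : ∀ i, unstableDet (A i).toLin' < γ i) :
    ∃ C : ι → ℝ, ∀ t : ℕ, ∃ S : ∀ i, Finset (ℕ → U i),
      (network fun i => linear (A i) (B i) (U i)).IsSpanning t Q (controlProduct S) ∧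
        ∀ i, (S i).card ≤ C i * γ i ^ t := by
  classical
  cases nonempty_fintype ι
  obtain ⟨ρ, hρ, h_nominal⟩ := exists_nominal_controls hU hQ hinv
  choose! ω hωU hωQ using h_nominal
  choose r hr C hC using fun i =>
    exists_finset_card_le_norm_transition_le_of_pos (hγ i) (h_steer i) hρ
  obtain ⟨P, hPQ, hP⟩ := hQ.elim_nhds_subcover
    (fun c => Set.univ.pi fun i => closedBall (c i) (r i)) fun c _ =>
      set_pi_mem_nhds Set.finite_univ fun i _ => closedBall_mem_nhds (c i) (hr i)
  refine ⟨fun i => P.card * C i, fun t => ?_⟩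
  choose V hV_card hV using fun i => hC i t
  have coe_injective (i : ι) : Function.Injective fun (w : ℕ → U i) k => (w k : Fin (m i) → ℝ) :=
    Subtype.val_injective.comp_left
  refine ⟨fun i => ((P ×ˢ V i).image fun p => (fun k => ω p.1 k i) + p.2).preimage _
    (coe_injective i).injOn, fun x hx => ?_, fun i => ?_⟩
  · obtain ⟨c, hcP, hxc⟩ := Set.mem_iUnion₂.1 (hP hx)
    choose v hvV hv_norm hv_transition using fun i =>
      hV i (x i - c i) (mem_closedBall_iff_norm.1 (hxc i (Set.mem_univ i)))
    have h_mem (k : ℕ) (i : ι) : ω c k i + v i k ∈ U i :=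
      hωU c (hPQ c hcP) k i (by
        rw [mem_closedBall_iff_norm, add_sub_cancel_left]
        exact hv_norm i k)
    refine ⟨fun k i => ⟨_, h_mem k i⟩, fun i => Finset.mem_preimage.2
      (Finset.mem_image_of_mem _ (Finset.mk_mem_product hcP (hvV i))), fun k hk hkt => ?_⟩
    exact hωQ c (hPQ c hcP) k hk
      (dist_transition_network_linear_le (fun _ _ => rfl) hρ.le fun i => hv_transition i k hkt)
  · calc _ ≤ (P.card : ℝ) * (V i).card := by
          exact_mod_cast card_preimage_image_add_le P (V i) (fun c k => ω c k i) (coe_injective i)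
      _ ≤ P.card * (C i * γ i ^ t) := by
          gcongr
          exact hV_card i
      _ = P.card * C i * γ i ^ t := (mul_assoc _ _ _).symm

end NominalControls

section EntropySet

open Filter

variable {ι : Type*} {X U : ι → Type*} [∀ i, TopologicalSpace (X i)]
  {C : ∀ i, ControlSystem (X i) (U i)} {Q : Set (∀ i, X i)}

theorem isClosed_networkEntropySet : IsClosed (networkEntropySet C Q) :=
  isClosed_biInter fun _ _ => isClosed_closure

theorem networkEntropySet_subset {s : Set (ι → ℝ)} (hs : IsClosed s)
    (h : ∀ t, 1 ≤ t → finiteTimeEntropySet C Q t ⊆ s) : networkEntropySet C Q ⊆ s :=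
  (Set.iInter₂_subset 1 one_pos).trans (closure_minimal (Set.iUnion₂_subset h) hs)

variable [∀ i, Nontrivial (U i)]

theorem mem_finiteTimeEntropySet_of_card_le {t : ℕ} {S : ∀ i, Finset (ℕ → U i)}
    (hS : (network C).IsSpanning t Q (controlProduct S)) {N : ι → ℕ} (hN : ∀ i, (S i).card ≤ N i) :
    (fun i => 1 / (t : ℝ) * Real.logb 2 (N i)) ∈ finiteTimeEntropySet C Q t := by
  choose S' hSS' hS'_card using fun i => Infinite.exists_superset_card_eq (S i) (N i) (hN i)
  refine ⟨S', fun x hx => ?_, fun i => by rw [hS'_card]⟩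
  obtain ⟨ω, hω, hωQ⟩ := hS x hx
  exact ⟨ω, fun i => hSS' i (hω i), hωQ⟩

theorem mem_networkEntropySet_of_forall_isSpanning [Finite ι] {a γ c : ι → ℝ}
    (hγ : ∀ i, 0 < γ i) (hγa : ∀ i, γ i < a i) (ha : ∀ i, 1 ≤ a i)
    (h : ∀ t : ℕ, ∃ S : ∀ i, Finset (ℕ → U i), (network C).IsSpanning t Q (controlProduct S) ∧
      ∀ i, (S i).card ≤ c i * γ i ^ t) :
    (fun i => Real.logb 2 (a i)) ∈ networkEntropySet C Q := by
  refine Set.mem_iInter₂.2 fun τ _ => mem_closure_of_tendsto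
    (tendsto_pi_nhds.2 fun i => tendsto_one_div_mul_logb_ceil_pow (ha i)) ?_
  filter_upwards [eventually_ge_atTop τ,
    eventually_all.2 fun i => eventually_mul_pow_le_pow (hγ i) (hγa i) (c i)] with t htτ ht
  obtain ⟨S, hS, hS_card⟩ := h t
  refine Set.mem_iUnion₂.2 ⟨t, htτ, mem_finiteTimeEntropySet_of_card_le hS fun i => ?_⟩
  exact Nat.cast_le.1 ((hS_card i).trans ((ht i).trans (Nat.le_ceil _)))

end EntropySet

section Linear

variable {ι : Type*} {d m : ι → ℕ} {A : ∀ i, Matrix (Fin (d i)) (Fin (d i)) ℝ}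
  {B : ∀ i, Matrix (Fin (d i)) (Fin (m i)) ℝ} {U : ∀ i, Set (Fin (m i) → ℝ)}
  {Q : Set (∀ i, Fin (d i) → ℝ)}

theorem unstableLogSum_le_of_mem_finiteTimeEntropySet (hQ : IsCompact Q)
    (hQ_int : (interior Q).Nonempty) {t : ℕ} (ht : 1 ≤ t) {ξ : ι → ℝ}
    (hξ : ξ ∈ finiteTimeEntropySet (fun i => linear (A i) (B i) (U i)) Q t) (i : ι) :
    unstableLogSum (A i) ≤ ξ i := by
  obtain ⟨S, hS, hξS⟩ := hξ
  have h_card : unstableDet (A i).toLin' ^ t ≤ (S i).card := by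
    refine unstableDet_pow_le_card _ (Q := Function.eval i '' Q)
      (hQ.image (continuous_apply i))
      ((hQ_int.image _).mono ((isOpenMap_eval i).image_interior_subset Q)) (b := fun ω =>
        (unconstrained (A i).toLin' (B i).toLin').transition (fun k => ω k) t 0) ?_
    rintro _ ⟨x, hx, rfl⟩
    obtain ⟨ω, hωS, hωQ⟩ := hS x hx
    refine ⟨_, hωS i, _, interior_subset (hωQ t ht le_rfl), ?_⟩
    rw [Function.eval_apply, Function.eval_apply, transition_network_apply, transition_linear,
      ← transition_unconstrained_add_left, add_zero]
  have h_pos : 0 < unstableDet (A i).toLin' := one_pos.trans_le (one_le_unstableDet _)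
  rw [hξS i, one_div, le_inv_mul_iff₀ (Nat.cast_pos.2 ht), unstableLogSum_eq_logb_unstableDet,
    ← Real.logb_pow]
  exact Real.logb_le_logb_of_le one_lt_two (pow_pos h_pos t) h_card

theorem StronglyInvariant.uniformlyNullSteerable (hQ : IsCompact Q) (hQ_int : (interior Q).Nonempty)
    (hinv : (network fun i => linear (A i) (B i) (U i)).StronglyInvariant Q) (i : ι) :
    UniformlyNullSteerable (A i).toLin' (B i).toLin' := by
  obtain ⟨K, hK, hKQ, h_steer⟩ := hinv.image_eval i
  obtain ⟨D, hD, hD_bdd, θ, hθ₀, hθ₁, h_contract⟩ := exists_steer_smul_of_steer_interior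
    (A := (A i).toLin') (B := (B i).toLin') (hQ.image (continuous_apply i))
    ((hQ_int.image _).mono ((isOpenMap_eval i).image_interior_subset Q)) hK hKQ fun x hx =>
      let ⟨u, hu⟩ := h_steer x hx
      ⟨u, interior_subset hu⟩
  exact uniformlyNullSteerable_of_steer_smul hD hD_bdd hθ₀ hθ₁ h_contract

theorem mem_networkEntropySet_of_unstableLogSum_lt [Finite ι] (hU_two : ∀ i, (U i).Nontrivial)
    (hU_reg : ∀ i, U i ⊆ closure (interior (U i))) (hQ : IsCompact Q)
    (hQ_int : (interior Q).Nonempty)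
    (hinv : (network fun i => linear (A i) (B i) (U i)).StronglyInvariant Q) {ξ : ι → ℝ}
    (hξ : ∀ i, unstableLogSum (A i) < ξ i) :
    ξ ∈ networkEntropySet (fun i => linear (A i) (B i) (U i)) Q := by
  have (i : ι) : Nontrivial (U i) := (hU_two i).coe_sort
  have h_pos (i : ι) : 0 < unstableDet (A i).toLin' := one_pos.trans_le (one_le_unstableDet _)
  have h_lt (i : ι) : unstableDet (A i).toLin' < 2 ^ ξ i := by
    rw [← Real.logb_lt_iff_lt_rpow one_lt_two (h_pos i), ← unstableLogSum_eq_logb_unstableDet]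
    exact hξ i
  choose γ hγ hγξ using fun i => exists_between (h_lt i)
  obtain ⟨c, hc⟩ := exists_isSpanning_card_le hU_reg hQ hinv
    (hinv.uniformlyNullSteerable hQ hQ_int) hγ
  have h_mem := mem_networkEntropySet_of_forall_isSpanning (fun i => (h_pos i).trans (hγ i)) hγξ
    (fun i => (one_le_unstableDet _).trans (h_lt i).le) hc
  simpa only [Real.logb_rpow two_pos (OfNat.ofNat_ne_one 2)] using h_mem

end Linear

end ControlSystem

theorem proposition5_general {ι : Type*} [Finite ι] {d m : ι → ℕ}
    {A : ∀ i, Matrix (Fin (d i)) (Fin (d i)) ℝ} {B : ∀ i, Matrix (Fin (d i)) (Fin (m i)) ℝ}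
    {U : ∀ i, Set (Fin (m i) → ℝ)} (hU_two : ∀ i, (U i).Nontrivial)
    (hU_reg : ∀ i, U i ⊆ closure (interior (U i))) {Q : Set (∀ i, Fin (d i) → ℝ)}
    (hQ_compact : IsCompact Q) (hQ_int : (interior Q).Nonempty)
    (hQ_inv : (ControlSystem.network fun i =>
      ControlSystem.linear (A i) (B i) (U i)).StronglyInvariant Q) :
    ControlSystem.networkEntropySet (fun i => ControlSystem.linear (A i) (B i) (U i)) Q =
      Set.univ.pi fun i => Set.Ici (unstableLogSum (A i)) := by
  refine Set.Subset.antisymm ?_ ?_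
  · exact ControlSystem.networkEntropySet_subset (isClosed_set_pi fun _ _ => isClosed_Ici)
      fun t ht ξ hξ i _ =>
        ControlSystem.unstableLogSum_le_of_mem_finiteTimeEntropySet hQ_compact hQ_int ht hξ i
  · simp only [← closure_Ioi, ← closure_pi_set]
    exact closure_minimal (fun ξ hξ => ControlSystem.mem_networkEntropySet_of_unstableLogSum_lt
      hU_two hU_reg hQ_compact hQ_int hQ_inv fun i => hξ i (Set.mem_univ i))
      ControlSystem.isClosed_networkEntropySet

theorem proposition5 (n : ℕ) (d m : Fin n → ℕ)
    (A : ∀ i, Matrix (Fin (d i)) (Fin (d i)) ℝ)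
    (B : ∀ i, Matrix (Fin (d i)) (Fin (m i)) ℝ)
    (U : ∀ i, Set (Fin (m i) → ℝ))
    (hU_two : ∀ i, (U i).Nontrivial)
    (hU_reg : ∀ i, U i ⊆ closure (interior (U i)))
    (hcontr : ∀ i, IsControllablePair (A i) (B i))
    (Q : Set (∀ i, Fin (d i) → ℝ))
    (hQ_compact : IsCompact Q)
    (hQ_int : (interior Q).Nonempty)
    (hQ_inv : (ControlSystem.network fun i =>
      ControlSystem.linear (A i) (B i) (U i)).StronglyInvariant Q) :
    ControlSystem.networkEntropySet (fun i => ControlSystem.linear (A i) (B i) (U i)) Q =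
      Set.univ.pi fun i => Set.Ici (unstableLogSum (A i)) :=
  proposition5_general hU_two hU_reg hQ_compact hQ_int hQ_inv
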